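/- Let $k=\mathbb R$ or $\mathbb C$ and let $\mathcal H$ be a topological Hopf algebra over $k$, that is, a complete Hausdorff nuclear locally convex space (for instance a nuclear Fréchet space, or the strong dual of one) with a jointly continuous unital associative multiplication, continuous linear maps $\Delta:\mathcal H\to\mathcal H\,\widehat\otimes_\pi\,\mathcal H$, $\varepsilon:\mathcal H\to k$ and an antipode $S:\mathcal H\to\mathcal H$ satisfying the Hopf algebra axioms, with $S$ invertible and $S^{-1}$ continuous. Here $\widehat\otimes_\pi$ is the completed projective tensor product. Let $\mathcal H^\circ$ be the strong dual of $\mathcal H$, with product $(\varphi\psi)(x)=\varphi(x_{(1)})\psi(x_{(2)})$, and let $B=B^{\rm top}_{AYD}(\mathcal H)=\mathcal H^\circ\,\widehat\otimes_\pi\,\mathcal H$, with unit $\varepsilon\otimes 1$ and multiplication given by the extension, by separate continuity, of $$(\varphi\otimes h)(\varphi'\otimes h')=\varphi'_{(1)}\big(S^{-1}(h_{(3)})\big)\,\varphi'_{(3)}\big(S^2(h_{(1)})\big)\;\varphi\varphi'_{(2)}\otimes h_{(2)}h',$$ where $\varphi'_{(1)}(a)\,\varphi'_{(2)}(x)\,\varphi'_{(3)}(b)=\varphi'(axb)$.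 For $\varphi\in\mathcal H^\circ$ and $h\in\mathcal H$ let $\lambda(\varphi\otimes h)(x)=\varphi(x)h$; this determines a linear bijection $\lambda$ from $B$ onto the space ${\rm End}(\mathcal H)$ of continuous linear endomorphisms of $\mathcal H$. Let $\rho=\sum_i f^i\otimes x_i\in B$ be the unique element with $\lambda(\rho)={\rm Id}_{\mathcal H}$. Let $V$ be a right $B$-module: a complete Hausdorff locally convex space with a unital, associative, separately continuous right action of $B$ such that the right $\mathcal H$-action $v\cdot h:=v\cdot(\varepsilon\otimes h)$ is jointly continuous. Let $$\nabla:V\to\mathcal H\,\widehat\otimes_\pi\,V,\qquad \nabla(v)=v_{(-1)}\otimes v_{(0)}:=\sum_i x_i\otimes v\cdot(f^i\otimes 1),$$ that is, $\nabla(v)$ is the image of $\rho$ under the continuous linear map $B\to\mathcal H\,\widehat\otimes_\pi\,V$ with $\varphi\otimes x\mapsto x\otimes v\cdot(\varphi\otimes 1)$. The module $V$ is called stable if $v_{(0)}\cdot v_{(-1)}=v$ for all $v\in V$. Then $V$ is stable if and only if $\{v\in V : v\cdot\rho=v\}=V$. The same equivalence holds if the multiplication of $B$ is instead given by $$(\varphi\otimes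 h)(\varphi'\otimes h')=\varphi'_{(1)}\big(S(h_{(3)})\big)\,\varphi'_{(3)}(h_{(1)})\;\varphi\varphi'_{(2)}\otimes h_{(2)}h'.$$ -/

import Mathlib

set_option linter.unusedSectionVars false

open Topology Filter UniformSpace
open scoped TensorProduct

namespace TopHopf

section Seminorms

variable {k : Type*} [RCLike k]
variable {E F G W : Type*}
variable [AddCommGroup E] [Module k E] [AddCommGroup F] [Module k F] [AddCommGroup G] [Module k G]
variable [AddCommGroup W] [Module k W]

theorem seminorm_ofReal_smul (p : Seminorm k E) {a : ℝ} (ha : 0 ≤ a) (x : E) :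
    p ((a : k) • x) = a * p x := by
  rw [map_smul_eq_mul, RCLike.norm_ofReal, abs_of_nonneg ha]

theorem exists_seminorm_of_mem_nhds [TopologicalSpace E] [PolynormableSpace k E] {U : Set E}
    (hU : U ∈ 𝓝 (0 : E)) :
    ∃ p : Seminorm k E, Continuous p ∧ ∀ x, p x < 1 → x ∈ U := by
  have hw := PolynormableSpace.withSeminorms k E
  obtain ⟨s, r, hr, hs⟩ := (hw.mem_nhds_iff 0 U).1 hU
  obtain ⟨Q, hQ⟩ : ∃ Q : Seminorm k E,
      Q = s.sup (fun p : {p : Seminorm k E // Continuous p} => p.1) := ⟨_, rfl⟩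
  have hc : Continuous Q := by
    rw [hQ]
    refine Finset.sup_induction (p := fun q : Seminorm k E => Continuous q) ?_ ?_ ?_
    · exact continuous_const
    · intro a ha b hb
      exact ha.sup hb
    · intro b _
      exact b.2
  rw [← hQ] at hs
  refine ⟨(Real.toNNReal r⁻¹) • Q, hc.const_smul (Real.toNNReal r⁻¹), fun x hx => hs ?_⟩
  rw [Seminorm.mem_ball_zero]
  have hx' : r⁻¹ * Q x < 1 := by
    have h2 : ((Real.toNNReal r⁻¹) • Q) x = r⁻¹ * Q x := by
      change (Real.toNNReal r⁻¹ : ℝ) * Q x = _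
      rw [Real.coe_toNNReal _ (inv_nonneg.2 hr.le)]
    rwa [h2] at hx
  rwa [inv_mul_lt_iff₀ hr, mul_one] at hx'

theorem le_mul_mul_of_forall_add {a b c d : ℝ}
    (h : ∀ ε > 0, d ≤ (a + ε) * (b + ε) * (c + ε)) : d ≤ a * b * c := by
  have h1 : Tendsto (fun ε : ℝ => (a + ε) * (b + ε) * (c + ε)) (𝓝[>] 0)
      (𝓝 ((a + 0) * (b + 0) * (c + 0))) := by
    apply tendsto_nhdsWithin_of_tendsto_nhds
    exact Continuous.tendsto (by fun_prop) 0
  simp only [add_zero] at h1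
  exact ge_of_tendsto h1 (eventually_mem_nhdsWithin.mono fun ε hε => h ε hε)

variable [TopologicalSpace E] [TopologicalSpace F] [TopologicalSpace G]
variable [PolynormableSpace k E] [PolynormableSpace k F] [PolynormableSpace k G]

theorem exists_bound₃ {N : E → F → G → ℝ}
    (hN : {z : E × F × G | N z.1 z.2.1 z.2.2 < 1} ∈ 𝓝 0)
    (hs : ∀ (a b c : ℝ) x y z, 0 ≤ a → 0 ≤ b → 0 ≤ c →
      N ((a : k) • x) ((b : k) • y) ((c : k) • z) = a * b * c * N x y z) :
    ∃ (p : Seminorm k E) (q : Seminorm k F) (s : Seminorm k G),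
      Continuous p ∧ Continuous q ∧ Continuous s ∧ ∀ x y z, N x y z ≤ p x * q y * s z := by
  obtain ⟨U, hU, V', hV', hUV'⟩ := mem_nhds_prod_iff.1 hN
  obtain ⟨V, hV, T, hT, hVT⟩ := mem_nhds_prod_iff.1 hV'
  obtain ⟨p, hp, hpU⟩ := exists_seminorm_of_mem_nhds (k := k) hU
  obtain ⟨q, hq, hqV⟩ := exists_seminorm_of_mem_nhds (k := k) hV
  obtain ⟨s, hs', hsT⟩ := exists_seminorm_of_mem_nhds (k := k) hT
  refine ⟨p, q, s, hp, hq, hs', fun x y z => le_mul_mul_of_forall_add fun ε hε => ?_⟩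
  have hx : 0 < p x + ε := by have := apply_nonneg p x; positivity
  have hy : 0 < q y + ε := by have := apply_nonneg q y; positivity
  have hz : 0 < s z + ε := by have := apply_nonneg s z; positivity
  have aux : ∀ t : ℝ, 0 ≤ t → (t + ε)⁻¹ * t < 1 := by
    intro t ht
    rw [inv_mul_lt_iff₀ (by positivity)]
    linarith
  have h1 : N ((((p x + ε)⁻¹ : ℝ) : k) • x) ((((q y + ε)⁻¹ : ℝ) : k) • y)
      ((((s z + ε)⁻¹ : ℝ) : k) • z) < 1 := by
    refine hUV' (a := (_, _, _)) (Set.mk_mem_prod (hpU _ ?_)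
      (hVT (Set.mk_mem_prod (hqV _ ?_) (hsT _ ?_))))
    · rw [seminorm_ofReal_smul p (inv_nonneg.2 hx.le)]
      exact aux _ (apply_nonneg p x)
    · rw [seminorm_ofReal_smul q (inv_nonneg.2 hy.le)]
      exact aux _ (apply_nonneg q y)
    · rw [seminorm_ofReal_smul s (inv_nonneg.2 hz.le)]
      exact aux _ (apply_nonneg s z)
  rw [hs _ _ _ _ _ _ (inv_nonneg.2 hx.le) (inv_nonneg.2 hy.le) (inv_nonneg.2 hz.le),
    ← mul_inv, ← mul_inv, inv_mul_lt_iff₀ (by positivity), mul_one] at h1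
  exact h1.le

theorem exists_bound₂ {N : E → F → ℝ} (hN : {z : E × F | N z.1 z.2 < 1} ∈ 𝓝 0)
    (hs : ∀ (a b : ℝ) x y, 0 ≤ a → 0 ≤ b → N ((a : k) • x) ((b : k) • y) = a * b * N x y) :
    ∃ (p : Seminorm k E) (q : Seminorm k F), Continuous p ∧ Continuous q ∧
      ∀ x y, N x y ≤ p x * q y := by
  obtain ⟨p, q, s, hp, hq, -, h⟩ := exists_bound₃ (k := k) (E := E) (F := F) (G := k)
    (N := fun x y c => N x y * ‖c‖)
    (by
      have h1 : ∀ᶠ w : E × F × k in 𝓝 0, N w.1 w.2.1 < 1 :=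
        (Continuous.tendsto' (f := fun w : E × F × k => (w.1, w.2.1)) (by fun_prop) 0 0 rfl).eventually
          hN
      have h2 : ∀ᶠ w : E × F × k in 𝓝 0, ‖w.2.2‖ < 1 :=
        (Continuous.tendsto' (f := fun w : E × F × k => ‖w.2.2‖) (by fun_prop) 0 0
          norm_zero).eventually (gt_mem_nhds one_pos)
      filter_upwards [h1, h2] with w hw hw'
      change N w.1 w.2.1 * ‖w.2.2‖ < 1
      have := norm_nonneg w.2.2
      rcases le_or_gt (N w.1 w.2.1) 0 with h | h
      · exact (mul_nonpos_of_nonpos_of_nonneg h this).trans_lt one_pos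
      · nlinarith)
    (by
      intro a b c x y z ha hb hc
      rw [hs a b x y ha hb, norm_smul, RCLike.norm_ofReal, abs_of_nonneg hc]
      ring)
  refine ⟨p, (Real.toNNReal (s 1)) • q, hp, hq.const_smul (Real.toNNReal (s 1)), fun x y => ?_⟩
  have h2 : ((Real.toNNReal (s 1)) • q) y = s 1 * q y := by
    change (Real.toNNReal (s 1) : ℝ) * q y = _
    rw [Real.coe_toNNReal _ (apply_nonneg s 1)]
  have := h x y 1
  rw [norm_one, mul_one] at this
  rw [h2]
  linarith

theorem continuous_bilin_of_bound [IsTopologicalAddGroup E] [IsTopologicalAddGroup F]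
    [TopologicalSpace W] {ι : Type*} {P : SeminormFamily k W ι} (hP : WithSeminorms P)
    (b : E →ₗ[k] F →ₗ[k] W)
    (h : ∀ i, ∃ (p : Seminorm k E) (q : Seminorm k F), Continuous p ∧ Continuous q ∧
      ∀ x y, P i (b x y) ≤ p x * q y) :
    Continuous fun z : E × F => b z.1 z.2 := by
  rw [continuous_iff_continuousAt]
  rintro ⟨x₀, y₀⟩
  have := hP.topologicalAddGroup
  refine (hP.tendsto_nhds _ _).2 fun i ε hε => ?_
  obtain ⟨p, q, hp, hq, hb⟩ := h i
  have h1 : Tendsto (fun z : E × F => p (z.1 - x₀) * q (z.2 - y₀) + p x₀ * q (z.2 - y₀)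
      + p (z.1 - x₀) * q y₀) (𝓝 (x₀, y₀)) (𝓝 0) := by
    have : Continuous (fun z : E × F => p (z.1 - x₀) * q (z.2 - y₀) + p x₀ * q (z.2 - y₀)
      + p (z.1 - x₀) * q y₀) := by fun_prop
    simpa using this.tendsto (x₀, y₀)
  filter_upwards [h1.eventually (gt_mem_nhds hε)] with z hz
  refine lt_of_le_of_lt ?_ hz
  have e : b z.1 z.2 - b x₀ y₀ = b (z.1 - x₀) (z.2 - y₀) + b x₀ (z.2 - y₀) + b (z.1 - x₀) y₀ := by
    simp only [map_sub, LinearMap.sub_apply]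
    abel
  rw [e]
  refine (map_add_le_add _ _ _).trans (add_le_add ((map_add_le_add _ _ _).trans ?_) (hb _ _))
  exact add_le_add (hb _ _) (hb _ _)

theorem mem_nhds_of_continuous {N : E → ℝ} (hN : Continuous N) (h0 : N 0 = 0) :
    {x | N x < 1} ∈ 𝓝 (0 : E) :=
  (isOpen_lt hN continuous_const).mem_nhds (by rw [Set.mem_ofPred_eq, h0]; exact one_pos)

/-- A bilinear map that is continuous at the origin is continuous. -/
theorem continuous_bilin_of_tendsto [IsTopologicalAddGroup E] [IsTopologicalAddGroup F]
    [TopologicalSpace W] [PolynormableSpace k W] (b : E →ₗ[k] F →ₗ[k] W)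
    (h : Tendsto (fun z : E × F => b z.1 z.2) (𝓝 0) (𝓝 0)) :
    Continuous fun z : E × F => b z.1 z.2 := by
  refine continuous_bilin_of_bound (PolynormableSpace.withSeminorms k W) b fun r => ?_
  refine exists_bound₂ (k := k) (N := fun x y => r.1 (b x y)) ?_ ?_
  · exact h (mem_nhds_of_continuous r.2 (map_zero r.1))
  · intro a c x y ha hc
    rw [LinearMap.map_smul, LinearMap.map_smul, LinearMap.smul_apply, seminorm_ofReal_smul _ hc,
      seminorm_ofReal_smul _ ha]
    ring

end Seminorms

section Completion

variable {k : Type*} [RCLike k] {X : Type*} [AddCommGroup X] [Module k X] [UniformSpace X]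
  [IsUniformAddGroup X] [UniformContinuousConstSMul k X]

theorem uniformContinuous_seminorm {p : Seminorm k X} (hp : Continuous p) :
    UniformContinuous p := by
  exact Seminorm.uniformContinuous_of_continuousAt_zero hp.continuousAt

/-- The extension of a continuous seminorm to the completion. -/
noncomputable def extSeminorm (p : Seminorm k X) (hp : Continuous p) :
    Seminorm k (Completion X) :=
  Seminorm.of (Completion.extension p)
    (fun x y => by
      induction x, y using Completion.induction_on₂ with
      | hp =>
        exact isClosed_le (Completion.continuous_extension.comp continuous_add)
          ((Completion.continuous_extension.comp continuous_fst).add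
            (Completion.continuous_extension.comp continuous_snd))
      | ih x y =>
        rw [← Completion.coe_add]
        simp only [Completion.extension_coe (uniformContinuous_seminorm hp)]
        exact map_add_le_add p x y)
    (fun a x => by
      induction x using Completion.induction_on with
      | hp =>
        exact isClosed_eq (Completion.continuous_extension.comp (continuous_const_smul a))
          (continuous_const.mul Completion.continuous_extension)
      | ih x =>
        rw [← Completion.coe_smul]
        simp only [Completion.extension_coe (uniformContinuous_seminorm hp)]
        exact map_smul_eq_mul p a x)

theorem extSeminorm_coe (p : Seminorm k X) (hp : Continuous p) (x : X) :
    extSeminorm p hp (x : Completion X) = p x :=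
  Completion.extension_coe (uniformContinuous_seminorm hp) x

theorem continuous_extSeminorm (p : Seminorm k X) (hp : Continuous p) :
    Continuous (extSeminorm p hp) :=
  Completion.continuous_extension

instance [PolynormableSpace k X] : PolynormableSpace k (Completion X) := by
  let P : SeminormFamily k (Completion X) {p : Seminorm k X // Continuous p} :=
    fun p => extSeminorm p.1 p.2
  suffices h : WithSeminorms P from h.toPolynormableSpace
  rw [SeminormFamily.withSeminorms_iff_nhds_eq_iInf]
  refine le_antisymm ?_ ?_
  · simp_rw [le_iInf_iff, ← tendsto_iff_comap]
    intro p
    exact (continuous_extSeminorm p.1 p.2).tendsto' 0 0 (map_zero _)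
  · intro U hU
    have hb := (𝓝 (0 : X)).basis_sets.hasBasis_of_isDenseInducing
      (Completion.isDenseInducing_coe (α := X))
    rw [Completion.coe_zero] at hb
    obtain ⟨V, hV, hVU⟩ := hb.mem_iff.1 hU
    obtain ⟨p, hp, hpV⟩ := exists_seminorm_of_mem_nhds (k := k) hV
    refine mem_iInf_of_mem ⟨p, hp⟩ (mem_comap.2 ⟨Set.Iio 1, Iio_mem_nhds one_pos, ?_⟩)
    intro x hx
    refine hVU ?_
    have hO : IsOpen {y : Completion X | extSeminorm p hp y < 1} :=
      isOpen_lt (continuous_extSeminorm p hp) continuous_const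
    have := Dense.open_subset_closure_inter (Completion.denseRange_coe (α := X)) hO hx
    refine closure_mono ?_ this
    rintro _ ⟨hy, x, rfl⟩
    refine ⟨x, hpV x ?_, rfl⟩
    have hy' : extSeminorm p hp (x : Completion X) < 1 := hy
    rwa [extSeminorm_coe] at hy'

end Completion

section Tensor

variable (k : Type*) [RCLike k] (E F G W : Type*)
variable [AddCommGroup E] [Module k E] [AddCommGroup F] [Module k F]
variable [AddCommGroup G] [Module k G] [AddCommGroup W] [Module k W]

/-- The algebraic tensor product `E ⊗ F`, to be equipped with the projective topology. -/
def ProjTensor : Type _ := E ⊗[k] F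

noncomputable instance : AddCommGroup (ProjTensor k E F) := inferInstanceAs (AddCommGroup (E ⊗[k] F))
noncomputable instance : Module k (ProjTensor k E F) := inferInstanceAs (Module k (E ⊗[k] F))

/-- The canonical bilinear map `E × F → E ⊗ F`. -/
noncomputable def ProjTensor.mk : E →ₗ[k] F →ₗ[k] ProjTensor k E F := TensorProduct.mk k E F

variable [TopologicalSpace E] [TopologicalSpace F]

/-- All seminorms `r` on `E ⊗ F` for which `(x, y) ↦ r (x ⊗ y)` is (jointly) continuous. -/
def ProjTensor.seminorms : SeminormFamily k (ProjTensor k E F)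
    {r : Seminorm k (ProjTensor k E F) //
      Continuous fun z : E × F => r (ProjTensor.mk k E F z.1 z.2)} :=
  fun r => r.1

instance : Nonempty {r : Seminorm k (ProjTensor k E F) //
      Continuous fun z : E × F => r (ProjTensor.mk k E F z.1 z.2)} :=
  ⟨⟨0, continuous_const⟩⟩

/-- The projective topology: the finest locally convex topology on `E ⊗ F` for which the
canonical bilinear map `E × F → E ⊗ F` is continuous. -/
noncomputable instance : UniformSpace (ProjTensor k E F) :=
  @IsTopologicalAddGroup.rightUniformSpace _ _
    (ProjTensor.seminorms k E F).moduleFilterBasis.topology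
    (ProjTensor.seminorms k E F).addGroupFilterBasis.isTopologicalAddGroup

theorem ProjTensor.withSeminorms : WithSeminorms (ProjTensor.seminorms k E F) := ⟨rfl⟩

instance : IsUniformAddGroup (ProjTensor k E F) :=
  @isUniformAddGroup_of_addCommGroup _ _
    (ProjTensor.seminorms k E F).moduleFilterBasis.topology
    (ProjTensor.seminorms k E F).addGroupFilterBasis.isTopologicalAddGroup

instance : ContinuousSMul k (ProjTensor k E F) := (ProjTensor.withSeminorms k E F).continuousSMul

instance : UniformContinuousConstSMul k (ProjTensor k E F) :=
  uniformContinuousConstSMul_of_continuousConstSMul _ _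

instance : PolynormableSpace k (ProjTensor k E F) :=
  (ProjTensor.withSeminorms k E F).toPolynormableSpace

/-- The completed projective tensor product `E ⊗̂_π F`. -/
abbrev CTensor : Type _ := Completion (ProjTensor k E F)

variable {E F}

/-- The canonical bilinear map `E × F → E ⊗̂_π F`. -/
noncomputable def tmul : E →ₗ[k] F →ₗ[k] CTensor k E F :=
  LinearMap.mk₂ k (fun x y => ((ProjTensor.mk k E F x y : ProjTensor k E F) : CTensor k E F))
    (fun x x' y => by rw [map_add, LinearMap.add_apply, Completion.coe_add])
    (fun c x y => by rw [map_smul, LinearMap.smul_apply, Completion.coe_smul])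
    (fun x y y' => by rw [map_add, Completion.coe_add])
    (fun c x y => by rw [map_smul, Completion.coe_smul])

variable {k} {W}

theorem ProjTensor.induction {C : ProjTensor k E F → Prop} (h0 : C 0)
    (ht : ∀ x y, C (ProjTensor.mk k E F x y)) (ha : ∀ u v, C u → C v → C (u + v))
    (u : ProjTensor k E F) : C u :=
  TensorProduct.induction_on (motive := C) u h0 ht ha

/-- A property that is closed, additive and holds on elementary tensors holds on `E ⊗̂_π F`. -/
theorem CTensor.induction {C : CTensor k E F → Prop} (hc : IsClosed {u | C u}) (h0 : C 0)
    (ht : ∀ x y, C (tmul k x y)) (ha : ∀ u v, C u → C v → C (u + v)) (u : CTensor k E F) : C u := by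
  induction u using Completion.induction_on with
  | hp => exact hc
  | ih u =>
    induction u using ProjTensor.induction with
    | h0 => rwa [Completion.coe_zero]
    | ht x y => exact ht x y
    | ha u v hu hv =>
      rw [Completion.coe_add]
      exact ha _ _ hu hv

theorem continuous_mk [IsTopologicalAddGroup E] [IsTopologicalAddGroup F]
    [PolynormableSpace k E] [PolynormableSpace k F] :
    Continuous fun z : E × F => ProjTensor.mk k E F z.1 z.2 := by
  refine continuous_bilin_of_bound (ProjTensor.withSeminorms k E F) _ fun r => ?_
  refine exists_bound₂ (k := k) (N := fun x y => r.1 (ProjTensor.mk k E F x y)) ?_ ?_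
  · refine (isOpen_lt r.2 continuous_const).mem_nhds ?_
    change r.1 (ProjTensor.mk k E F 0 0) < 1
    rw [map_zero, map_zero]
    exact one_pos
  · intro a b x y ha hb
    rw [LinearMap.map_smul, LinearMap.map_smul, LinearMap.smul_apply, seminorm_ofReal_smul _ hb,
      seminorm_ofReal_smul _ ha]
    ring

theorem continuous_tmul [IsTopologicalAddGroup E] [IsTopologicalAddGroup F]
    [PolynormableSpace k E] [PolynormableSpace k F] :
    Continuous fun z : E × F => tmul k z.1 z.2 :=
  (Completion.continuous_coe _).comp continuous_mk

section Lift

variable [UniformSpace W] [IsUniformAddGroup W] [ContinuousSMul k W] [PolynormableSpace k W]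

/-- The linear map on the algebraic tensor product induced by a continuous bilinear map. -/
noncomputable def projLift (b : E →ₗ[k] F →ₗ[k] W) (hb : Continuous fun z : E × F => b z.1 z.2) :
    ProjTensor k E F →L[k] W where
  toLinearMap := (TensorProduct.lift b : E ⊗[k] F →ₗ[k] W)
  cont := by
    refine WithSeminorms.continuous_of_isBounded (ProjTensor.withSeminorms k E F)
      (PolynormableSpace.withSeminorms k W) _ fun r => ?_
    refine ⟨{⟨r.1.comp (TensorProduct.lift b : E ⊗[k] F →ₗ[k] W), r.2.comp hb⟩}, 1, ?_⟩
    rw [Finset.sup_singleton, one_smul]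
    exact le_rfl

variable [T2Space W] [CompleteSpace W]

/-- The continuous linear map `E ⊗̂_π F → W` induced by a continuous bilinear map `E × F → W`. -/
noncomputable def lift (b : E →ₗ[k] F →ₗ[k] W) (hb : Continuous fun z : E × F => b z.1 z.2) :
    CTensor k E F →L[k] W :=
  haveI : UniformContinuousConstSMul k W := uniformContinuousConstSMul_of_continuousConstSMul _ _
  (projLift b hb).fromCompletion

theorem lift_coe (b : E →ₗ[k] F →ₗ[k] W) (hb : Continuous fun z : E × F => b z.1 z.2)
    (u : ProjTensor k E F) : lift b hb (u : CTensor k E F) = projLift b hb u :=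
  haveI : UniformContinuousConstSMul k W := uniformContinuousConstSMul_of_continuousConstSMul _ _
  (projLift b hb).fromCompletion_apply_coe u

theorem projLift_mk (b : E →ₗ[k] F →ₗ[k] W) (hb : Continuous fun z : E × F => b z.1 z.2)
    (x : E) (y : F) : projLift b hb (ProjTensor.mk k E F x y) = b x y :=
  TensorProduct.lift.tmul x y

@[simp]
theorem lift_tmul (b : E →ₗ[k] F →ₗ[k] W) (hb : Continuous fun z : E × F => b z.1 z.2)
    (x : E) (y : F) : lift b hb (tmul k x y) = b x y :=
  (lift_coe b hb _).trans (projLift_mk b hb x y)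

end Lift

end Tensor

section Maps

variable {k : Type*} [RCLike k] {E F G W E' F' A B C D : Type*}
variable [AddCommGroup E] [Module k E] [UniformSpace E] [IsUniformAddGroup E] [PolynormableSpace k E]
variable [AddCommGroup F] [Module k F] [UniformSpace F] [IsUniformAddGroup F] [PolynormableSpace k F]
variable [AddCommGroup G] [Module k G] [UniformSpace G] [IsUniformAddGroup G] [PolynormableSpace k G]
variable [AddCommGroup E'] [Module k E'] [UniformSpace E'] [IsUniformAddGroup E']
  [PolynormableSpace k E']
variable [AddCommGroup F'] [Module k F'] [UniformSpace F'] [IsUniformAddGroup F']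
  [PolynormableSpace k F']
variable [AddCommGroup A] [Module k A] [UniformSpace A] [IsUniformAddGroup A] [PolynormableSpace k A]
variable [AddCommGroup B] [Module k B] [UniformSpace B] [IsUniformAddGroup B] [PolynormableSpace k B]
variable [AddCommGroup C] [Module k C] [UniformSpace C] [IsUniformAddGroup C] [PolynormableSpace k C]
variable [AddCommGroup D] [Module k D] [UniformSpace D] [IsUniformAddGroup D] [PolynormableSpace k D]

theorem CTensor.ext_map [AddCommGroup W] [Module k W] [TopologicalSpace W] [T2Space W]
    {f g : CTensor k E F →L[k] W}
    (h : ∀ x y, f (tmul k x y) = g (tmul k x y)) : f = g := by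
  ext u
  induction u using CTensor.induction with
  | hc => exact isClosed_eq f.continuous g.continuous
  | h0 => rw [map_zero, map_zero]
  | ht x y => exact h x y
  | ha u v hu hv => rw [map_add, map_add, hu, hv]

instance : ContinuousSMul k (CTensor k E F) :=
  (PolynormableSpace.withSeminorms k (CTensor k E F)).continuousSMul

theorem continuous_tmul_comp {T : Type*} [TopologicalSpace T] {f : T → E} {g : T → F}
    (hf : Continuous f) (hg : Continuous g) : Continuous fun z => tmul k (f z) (g z) :=
  (continuous_tmul (k := k) (E := E) (F := F)).comp (hf.prodMk hg)

/-- The flip `E ⊗̂ F → F ⊗̂ E`. -/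
noncomputable def comm : CTensor k E F →L[k] CTensor k F E :=
  lift (tmul k).flip (continuous_tmul.comp continuous_swap)

@[simp]
theorem comm_tmul (x : E) (y : F) : comm (tmul k x y) = tmul k y x :=
  lift_tmul _ _ x y

/-- The completed tensor product `f ⊗̂ g` of two continuous linear maps. -/
noncomputable def map (f : E →L[k] E') (g : F →L[k] F') : CTensor k E F →L[k] CTensor k E' F' :=
  lift ((tmul k).compl₁₂ f.toLinearMap g.toLinearMap)
    (continuous_tmul.comp ((f.continuous.comp continuous_fst).prodMk
      (g.continuous.comp continuous_snd)))

@[simp]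
theorem map_tmul (f : E →L[k] E') (g : F →L[k] F') (x : E) (y : F) :
    map f g (tmul k x y) = tmul k (f x) (g y) :=
  lift_tmul _ _ x y

/-- The projective seminorm `p ⊗_π q`: the largest seminorm `ν` on `E ⊗ F` with
`ν (x ⊗ y) ≤ p x * q y`. -/
noncomputable def projSem (p : Seminorm k E) (q : Seminorm k F) : Seminorm k (ProjTensor k E F) :=
  sSup {ν | ∀ x y, ν (ProjTensor.mk k E F x y) ≤ p x * q y}

theorem projSem_bddAbove (p : Seminorm k E) (q : Seminorm k F) :
    BddAbove {ν : Seminorm k (ProjTensor k E F) |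
      ∀ x y, ν (ProjTensor.mk k E F x y) ≤ p x * q y} := by
  rw [Seminorm.bddAbove_iff, bddAbove_pi]
  intro u
  suffices h : ∃ c : ℝ, ∀ ν : Seminorm k (ProjTensor k E F),
      (∀ x y, ν (ProjTensor.mk k E F x y) ≤ p x * q y) → ν u ≤ c by
    obtain ⟨c, hc⟩ := h
    refine ⟨c, ?_⟩
    rintro _ ⟨_, ⟨ν, hν, rfl⟩, rfl⟩
    exact hc ν hν
  induction u using ProjTensor.induction with
  | h0 => exact ⟨0, fun ν _ => (map_zero ν).le⟩
  | ht x y => exact ⟨_, fun ν hν => hν x y⟩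
  | ha u v hu hv =>
    obtain ⟨c, hc⟩ := hu
    obtain ⟨d, hd⟩ := hv
    exact ⟨c + d, fun ν hν => (map_add_le_add ν u v).trans (add_le_add (hc ν hν) (hd ν hν))⟩

theorem le_projSem {p : Seminorm k E} {q : Seminorm k F} {ν : Seminorm k (ProjTensor k E F)}
    (h : ∀ x y, ν (ProjTensor.mk k E F x y) ≤ p x * q y) : ν ≤ projSem p q :=
  le_csSup (projSem_bddAbove p q) h

theorem projSem_mk_le (p : Seminorm k E) (q : Seminorm k F) (x : E) (y : F) :
    projSem p q (ProjTensor.mk k E F x y) ≤ p x * q y := by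
  rw [projSem, Seminorm.sSup_apply (projSem_bddAbove p q)]
  have : Nonempty {ν : Seminorm k (ProjTensor k E F) |
      ∀ x y, ν (ProjTensor.mk k E F x y) ≤ p x * q y} :=
    ⟨⟨0, fun x y => mul_nonneg (apply_nonneg p x) (apply_nonneg q y)⟩⟩
  exact ciSup_le fun ν => ν.2 x y

theorem continuous_of_mk_le {p : Seminorm k E} {q : Seminorm k F} (hp : Continuous p)
    (hq : Continuous q) {ν : Seminorm k (ProjTensor k E F)}
    (h : ∀ x y, ν (ProjTensor.mk k E F x y) ≤ p x * q y) : Continuous ν := by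
  have hc : Continuous fun z : E × F => ν (ProjTensor.mk k E F z.1 z.2) := by
    rw [continuous_iff_continuousAt]
    rintro ⟨x₀, y₀⟩
    have h1 : Tendsto (fun z : E × F => p (z.1 - x₀) * q (z.2 - y₀) + p x₀ * q (z.2 - y₀)
        + p (z.1 - x₀) * q y₀) (𝓝 (x₀, y₀)) (𝓝 0) := by
      have : Continuous (fun z : E × F => p (z.1 - x₀) * q (z.2 - y₀) + p x₀ * q (z.2 - y₀)
        + p (z.1 - x₀) * q y₀) := by fun_prop
      simpa using this.tendsto (x₀, y₀)
    refine tendsto_iff_dist_tendsto_zero.2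
      (squeeze_zero (fun _ => dist_nonneg) (fun z => ?_) h1)
    rw [Real.dist_eq]
    refine (abs_sub_map_le_sub ν _ _).trans ?_
    have e : ProjTensor.mk k E F z.1 z.2 - ProjTensor.mk k E F x₀ y₀
        = ProjTensor.mk k E F (z.1 - x₀) (z.2 - y₀) + ProjTensor.mk k E F x₀ (z.2 - y₀)
          + ProjTensor.mk k E F (z.1 - x₀) y₀ := by
      simp only [map_sub, LinearMap.sub_apply]
      abel
    rw [e]
    refine (map_add_le_add _ _ _).trans (add_le_add ((map_add_le_add _ _ _).trans ?_) (h _ _))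
    exact add_le_add (h _ _) (h _ _)
  exact (ProjTensor.withSeminorms k E F).continuous_seminorm ⟨ν, hc⟩

section LiftThree

variable [AddCommGroup W] [Module k W] [UniformSpace W] [IsUniformAddGroup W] [ContinuousSMul k W]
  [PolynormableSpace k W] [T2Space W] [CompleteSpace W]

/-- A map of three variables that is linear in each of them and jointly continuous. -/
structure IsContTrilinear (k : Type*) [RCLike k] {E F G W : Type*}
    [AddCommGroup E] [Module k E] [TopologicalSpace E]
    [AddCommGroup F] [Module k F] [TopologicalSpace F]
    [AddCommGroup G] [Module k G] [TopologicalSpace G]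
    [AddCommGroup W] [Module k W] [TopologicalSpace W] (t : E → F → G → W) : Prop where
  fst : ∀ y z, IsLinearMap k fun x => t x y z
  snd : ∀ x z, IsLinearMap k fun y => t x y z
  thd : ∀ x y, IsLinearMap k fun z => t x y z
  cont : Continuous fun w : E × F × G => t w.1 w.2.1 w.2.2

variable {t : E → F → G → W}

/-- For fixed `x`, the continuous linear extension of `(y, z) ↦ t x y z` to `F ⊗̂ G`. -/
noncomputable def liftSnd (ht : IsContTrilinear k t) (x : E) : CTensor k F G →L[k] W :=
  lift (LinearMap.mk₂ k (fun y z => t x y z) (fun y y' z => (ht.snd x z).map_add y y')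
      (fun c y z => (ht.snd x z).map_smul c y) (fun y z z' => (ht.thd x y).map_add z z')
      (fun c y z => (ht.thd x y).map_smul c z))
    (ht.cont.comp (continuous_const.prodMk continuous_id))

@[simp]
theorem liftSnd_tmul (ht : IsContTrilinear k t) (x : E) (y : F) (z : G) :
    liftSnd ht x (tmul k y z) = t x y z :=
  lift_tmul _ _ y z

theorem continuous_liftSnd (ht : IsContTrilinear k t) (b : E →ₗ[k] CTensor k F G →ₗ[k] W)
    (hb : ∀ x u, b x u = liftSnd ht x u) : Continuous fun z : E × CTensor k F G => b z.1 z.2 := by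
  refine continuous_bilin_of_bound (PolynormableSpace.withSeminorms k W) b fun r => ?_
  obtain ⟨p, q, s, hp, hq, hs, h⟩ := exists_bound₃ (k := k) (N := fun x y z => r.1 (t x y z))
    (by
      refine (isOpen_lt (r.2.comp ht.cont) continuous_const).mem_nhds ?_
      change r.1 (t 0 0 0) < 1
      rw [(ht.fst 0 0).map_zero, map_zero]
      exact one_pos) (by
      intro a b c x y z ha hb hc
      rw [(ht.fst _ _).map_smul, (ht.snd _ _).map_smul, (ht.thd _ _).map_smul,
        seminorm_ofReal_smul _ ha, seminorm_ofReal_smul _ hb, seminorm_ofReal_smul _ hc]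
      ring)
  have hν : Continuous (projSem q s) := continuous_of_mk_le hq hs (projSem_mk_le q s)
  refine ⟨p, extSeminorm (projSem q s) hν, hp, continuous_extSeminorm _ hν, fun x u => ?_⟩
  rw [hb]
  induction u using Completion.induction_on with
  | hp =>
    exact isClosed_le (r.2.comp (liftSnd ht x).continuous)
      (continuous_const.mul (continuous_extSeminorm _ hν))
  | ih u =>
    rw [extSeminorm_coe]
    obtain ⟨f, hf⟩ : ∃ f : ProjTensor k F G →ₗ[k] CTensor k F G,
        ∀ v : ProjTensor k F G, f v = (v : CTensor k F G) :=
      ⟨{ toFun := fun v => (v : CTensor k F G)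
         map_add' := Completion.coe_add
         map_smul' := Completion.coe_smul }, fun v => rfl⟩
    obtain ⟨R, hR⟩ : ∃ R : Seminorm k W, R = r.1 := ⟨_, rfl⟩
    obtain ⟨N, hN'⟩ : ∃ N : Seminorm k (ProjTensor k F G),
        ∀ v : ProjTensor k F G, N v = R (liftSnd ht x (v : CTensor k F G)) :=
      ⟨R.comp ((liftSnd ht x).toLinearMap.comp f), fun v => by
        rw [Seminorm.comp_apply, LinearMap.comp_apply, hf]
        rfl⟩
    rw [hR] at hN'
    have hN : ∀ y z, N (ProjTensor.mk k F G y z) ≤ p x * q y * s z := by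
      intro y z
      rw [hN']
      refine le_of_eq_of_le ?_ (h x y z)
      exact congrArg r.1 (liftSnd_tmul ht x y z)
    refine le_of_eq_of_le (hN' u).symm ?_
    have key : ∀ ε > 0, N u ≤ (p x + ε) * projSem q s u := by
      intro ε hε
      have hpos : 0 < p x + ε := by have := apply_nonneg p x; positivity
      have hle : (Real.toNNReal (p x + ε)⁻¹) • N ≤ projSem q s := by
        refine le_projSem fun y z => ?_
        change (Real.toNNReal (p x + ε)⁻¹ : ℝ) * N _ ≤ _
        rw [Real.coe_toNNReal _ (inv_nonneg.2 hpos.le), inv_mul_le_iff₀ hpos]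
        refine (hN y z).trans ?_
        rw [mul_assoc]
        exact mul_le_mul_of_nonneg_right (by linarith)
          (mul_nonneg (apply_nonneg q y) (apply_nonneg s z))
      have h2 : (Real.toNNReal (p x + ε)⁻¹ : ℝ) * N u ≤ projSem q s u := hle u
      rwa [Real.coe_toNNReal _ (inv_nonneg.2 hpos.le), inv_mul_le_iff₀ hpos] at h2
    have h1 : Tendsto (fun ε : ℝ => (p x + ε) * projSem q s u) (𝓝[>] 0)
        (𝓝 ((p x + 0) * projSem q s u)) := by
      apply tendsto_nhdsWithin_of_tendsto_nhds
      exact Continuous.tendsto (by fun_prop) 0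
    rw [add_zero] at h1
    exact ge_of_tendsto h1 (eventually_mem_nhdsWithin.mono fun ε hε => key ε hε)

/-- The continuous linear map `E ⊗̂ (F ⊗̂ G) → W` induced by a jointly continuous trilinear map. -/
noncomputable def lift₃ (t : E → F → G → W) (ht : IsContTrilinear k t) :
    CTensor k E (CTensor k F G) →L[k] W :=
  lift
    { toFun := fun x => (liftSnd ht x).toLinearMap
      map_add' := fun x x' => by
        have : liftSnd ht (x + x') = liftSnd ht x + liftSnd ht x' :=
          CTensor.ext_map fun y z => by
            simp only [liftSnd_tmul, add_apply, (ht.fst y z).map_add]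
        rw [this]
        rfl
      map_smul' := fun c x => by
        have : liftSnd ht (c • x) = c • liftSnd ht x :=
          CTensor.ext_map fun y z => by
            simp only [liftSnd_tmul, smul_apply, (ht.fst y z).map_smul]
        rw [this]
        rfl }
    (continuous_liftSnd ht _ fun _ _ => rfl)

@[simp]
theorem lift₃_tmul (ht : IsContTrilinear k t) (x : E) (y : F) (z : G) :
    lift₃ t ht (tmul k x (tmul k y z)) = t x y z :=
  (lift_tmul _ _ x _).trans (liftSnd_tmul ht x y z)

end LiftThree

theorem isContTrilinear_assocInv :
    IsContTrilinear k fun (x : E) (y : F) (z : G) => tmul k (tmul k x y) z where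
  fst y z := ⟨fun a b => by simp, fun c a => by simp⟩
  snd x z := ⟨fun a b => by simp, fun c a => by simp⟩
  thd x y := ⟨fun a b => by simp, fun c a => by simp⟩
  cont := continuous_tmul_comp (continuous_tmul_comp continuous_fst (continuous_fst.comp continuous_snd))
    (continuous_snd.comp continuous_snd)

theorem isContTrilinear_assoc :
    IsContTrilinear k fun (z : G) (x : E) (y : F) => tmul k x (tmul k y z) where
  fst y z := ⟨fun a b => by simp, fun c a => by simp⟩
  snd x z := ⟨fun a b => by simp, fun c a => by simp⟩
  thd x y := ⟨fun a b => by simp, fun c a => by simp⟩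
  cont := continuous_tmul_comp (continuous_fst.comp continuous_snd)
    (continuous_tmul_comp (continuous_snd.comp continuous_snd) continuous_fst)

/-- The associator `(E ⊗̂ F) ⊗̂ G → E ⊗̂ (F ⊗̂ G)`. -/
noncomputable def assoc : CTensor k (CTensor k E F) G →L[k] CTensor k E (CTensor k F G) :=
  (lift₃ _ isContTrilinear_assoc).comp comm

/-- The inverse associator `E ⊗̂ (F ⊗̂ G) → (E ⊗̂ F) ⊗̂ G`. -/
noncomputable def assocInv : CTensor k E (CTensor k F G) →L[k] CTensor k (CTensor k E F) G :=
  lift₃ _ isContTrilinear_assocInv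

@[simp]
theorem assoc_tmul (x : E) (y : F) (z : G) :
    assoc (tmul k (tmul k x y) z) = tmul k x (tmul k y z) := by
  rw [assoc, ContinuousLinearMap.comp_apply, comm_tmul, lift₃_tmul]

@[simp]
theorem assocInv_tmul (x : E) (y : F) (z : G) :
    assocInv (tmul k x (tmul k y z)) = tmul k (tmul k x y) z :=
  lift₃_tmul _ x y z

/-- The middle-four interchange `(A ⊗̂ B) ⊗̂ (C ⊗̂ D) → (A ⊗̂ C) ⊗̂ (B ⊗̂ D)`. -/
noncomputable def interchange :
    CTensor k (CTensor k A B) (CTensor k C D) →L[k] CTensor k (CTensor k A C) (CTensor k B D) :=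
  assocInv.comp ((map (.id k A)
    (assoc.comp ((map comm (.id k D)).comp assocInv))).comp assoc)

@[simp]
theorem interchange_tmul (a : A) (b : B) (c : C) (d : D) :
    interchange (tmul k (tmul k a b) (tmul k c d)) = tmul k (tmul k a c) (tmul k b d) := by
  simp [interchange]

end Maps

section Nuclear

/-- A (locally convex) space `E` is nuclear if for every continuous seminorm `p` there is a
continuous seminorm `q` such that the canonical map `E_q → Ê_p` of local Banach spaces is nuclear:
`x = ∑ f_n(x) y_n` in `Ê_p`, with `|f_n| ≤ q` and `∑ p(y_n) < ∞` (since `E` is dense in `Ê_p`, the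
vectors `y_n` can be taken in `E`). -/
class NuclearSpace (k E : Type*) [RCLike k] [AddCommGroup E] [Module k E] [TopologicalSpace E] :
    Prop extends PolynormableSpace k E where
  nuclear : ∀ p : Seminorm k E, Continuous p →
    ∃ q : Seminorm k E, Continuous q ∧ ∃ (f : ℕ → StrongDual k E) (y : ℕ → E),
      (∀ n x, ‖f n x‖ ≤ q x) ∧ Summable (fun n => p (y n)) ∧
      ∀ x, Tendsto (fun N => p (x - ∑ n ∈ Finset.range N, f n x • y n)) atTop (𝓝 0)

variable {k : Type*} [RCLike k] {E : Type*} [AddCommGroup E] [Module k E] [UniformSpace E]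
  [IsUniformAddGroup E] [ContinuousSMul k E]

open Bornology

theorem nhds_dual_bound {S : Set E} (hS : IsVonNBounded k S) {ε : ℝ} (hε : 0 < ε) :
    {φ : StrongDual k E | ∀ x ∈ S, ‖φ x‖ < ε} ∈ 𝓝 (0 : StrongDual k E) := by
  have := (ContinuousLinearMap.hasBasis_nhds_zero (σ := RingHom.id k) (E := E) (F := k)).mem_of_mem
    (i := (S, Metric.ball 0 ε)) ⟨hS, Metric.ball_mem_nhds 0 hε⟩
  refine mem_of_superset this fun φ hφ x hx => ?_
  exact mem_ball_zero_iff.1 (hφ x hx)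

theorem exists_dual_bound {U : Set (StrongDual k E)} (hU : U ∈ 𝓝 (0 : StrongDual k E)) :
    ∃ S : Set E, IsVonNBounded k S ∧ ∃ ε > 0, ∀ φ : StrongDual k E, (∀ x ∈ S, ‖φ x‖ < ε) → φ ∈ U := by
  obtain ⟨⟨S, V⟩, ⟨hS, hV⟩, h⟩ :=
    (ContinuousLinearMap.hasBasis_nhds_zero (σ := RingHom.id k) (E := E) (F := k)).mem_iff.1 hU
  obtain ⟨ε, hε, hεV⟩ := Metric.mem_nhds_iff.1 hV
  exact ⟨S, hS, ε, hε, fun φ hφ => h fun x hx => hεV (mem_ball_zero_iff.2 (hφ x hx))⟩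

theorem exists_bound_on {S : Set E} (hS : IsVonNBounded k S) {p : Seminorm k E}
    (hp : Continuous p) : ∃ M > 0, ∀ x ∈ S, p x ≤ M := by
  have h : p.ball 0 1 ∈ 𝓝 (0 : E) := p.ball_mem_nhds hp one_pos
  obtain ⟨r, hr, hrS⟩ := (hS h).exists_pos
  refine ⟨r, hr, fun x hx => ?_⟩
  have h2 := hrS (r : k) (by rw [RCLike.norm_ofReal, abs_of_pos hr]) hx
  obtain ⟨y, hy, rfl⟩ := Set.mem_smul_set.1 h2
  rw [seminorm_ofReal_smul p hr.le]
  rw [Seminorm.mem_ball_zero] at hy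
  nlinarith

/-- The seminorm `φ ↦ |φ x|` on the dual. -/
def evalSeminorm (x : E) : Seminorm k (StrongDual k E) :=
  Seminorm.of (fun φ => ‖φ x‖) (fun φ ψ => norm_add_le (φ x) (ψ x)) (fun c φ => norm_mul c (φ x))

theorem bddAbove_evalSeminorm {S : Set E} (hS : IsVonNBounded k S) :
    BddAbove (Set.range fun x : S => evalSeminorm (k := k) (x : E)) := by
  rw [Seminorm.bddAbove_range_iff]
  intro φ
  obtain ⟨M, -, hM⟩ := exists_bound_on hS (p := (normSeminorm k k).comp φ.toLinearMap)
    (continuous_norm.comp φ.continuous)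
  refine ⟨M, ?_⟩
  rintro _ ⟨x, rfl⟩
  exact hM x x.2

/-- The strong topology of the dual is given by the seminorms `sup_{x ∈ S} |φ x|`, `S` bounded. -/
instance : PolynormableSpace k (StrongDual k E) := by
  let P : SeminormFamily k (StrongDual k E) {S : Set E // IsVonNBounded k S} :=
    fun S => ⨆ x : S.1, evalSeminorm (x : E)
  suffices h : WithSeminorms P from h.toPolynormableSpace
  rw [SeminormFamily.withSeminorms_iff_nhds_eq_iInf]
  refine le_antisymm ?_ ?_
  · simp_rw [le_iInf_iff, ← tendsto_iff_comap]
    intro S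
    rw [Metric.tendsto_nhds]
    intro ε hε
    filter_upwards [nhds_dual_bound S.2 (half_pos hε)] with φ hφ
    rw [Real.dist_eq, sub_zero, abs_of_nonneg (apply_nonneg _ _)]
    refine lt_of_le_of_lt ?_ (half_lt_self hε)
    change (⨆ x : S.1, evalSeminorm (x : E)) φ ≤ _
    rw [Seminorm.iSup_apply (bddAbove_evalSeminorm S.2)]
    exact Real.iSup_le (fun x => (hφ x x.2).le) (half_pos hε).le
  · intro U hU
    obtain ⟨S, hS, ε, hε, h⟩ := exists_dual_bound hU
    refine mem_iInf_of_mem ⟨S, hS⟩ (mem_comap.2 ⟨Set.Iio ε, Iio_mem_nhds hε, ?_⟩)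
    intro φ hφ
    refine h φ fun x hx => lt_of_le_of_lt ?_ hφ
    change _ ≤ (⨆ x : S, evalSeminorm (x : E)) φ
    rw [Seminorm.iSup_apply (bddAbove_evalSeminorm hS)]
    exact le_ciSup (f := fun x : S => evalSeminorm (x : E) φ)
      (Seminorm.bddAbove_range_iff.1 (bddAbove_evalSeminorm hS) φ) ⟨x, hx⟩

section Lambda

variable [PolynormableSpace k E] [T2Space E] [CompleteSpace E]

/-- For `x : E`, the continuous linear map `E° ⊗̂ E → E`, `φ ⊗ y ↦ φ x • y`. -/
noncomputable def lamAt (x : E) : CTensor k (StrongDual k E) E →L[k] E :=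
  lift (LinearMap.mk₂ k (fun (φ : StrongDual k E) (y : E) => φ x • y)
      (fun φ ψ y => by rw [add_apply, add_smul])
      (fun c φ y => by rw [smul_apply, smul_eq_mul, mul_smul])
      (fun φ y z => smul_add _ y z) (fun c φ y => smul_comm _ c y))
    (((continuous_eval_const x).comp continuous_fst).smul continuous_snd)

@[simp]
theorem lamAt_tmul (x : E) (φ : StrongDual k E) (y : E) : lamAt x (tmul k φ y) = φ x • y :=
  lift_tmul _ _ φ y

/-- The canonical linear map `λ : E° ⊗̂ E → End(E)`, `λ(φ ⊗ y)(x) = φ(x) y`. -/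
noncomputable def lam : CTensor k (StrongDual k E) E →ₗ[k] E →ₗ[k] E :=
  LinearMap.mk₂ k (fun b x => lamAt x b) (fun b c x => map_add _ b c)
    (fun c b x => map_smul _ c b)
    (fun b x x' => by
      have : lamAt (k := k) (x + x') = lamAt x + lamAt x' :=
        CTensor.ext_map fun φ y => by
          rw [add_apply, lamAt_tmul, lamAt_tmul, lamAt_tmul, map_add, add_smul]
      rw [this, add_apply])
    (fun c b x => by
      have : lamAt (k := k) (c • x) = c • lamAt x :=
        CTensor.ext_map fun φ y => by
          rw [smul_apply, lamAt_tmul, lamAt_tmul, map_smul, smul_eq_mul, mul_smul]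
      rw [this, smul_apply])

theorem lam_tmul (φ : StrongDual k E) (x y : E) : lam (tmul k φ y) x = φ x • y :=
  lamAt_tmul x φ y

end Lambda

end Nuclear

section LambdaBijective

open Bornology

variable {k : Type*} [RCLike k] {E : Type*} [AddCommGroup E] [Module k E] [UniformSpace E]
  [IsUniformAddGroup E] [ContinuousSMul k E]

theorem seminorm_sum_le {X ι : Type*} [AddCommGroup X] [Module k X] (p : Seminorm k X)
    (s : Finset ι) (g : ι → X) : p (∑ i ∈ s, g i) ≤ ∑ i ∈ s, p (g i) :=
  Finset.le_sum_of_subadditive p (map_zero p).le (map_add_le_add p) s g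

theorem mk_induced (r : Seminorm k (ProjTensor k (StrongDual k E) E)) [PolynormableSpace k E]
    (hr : Continuous r) :
    ∃ (S : Set E) (Q : Seminorm k E), IsVonNBounded k S ∧ Continuous Q ∧
      ∀ (φ : StrongDual k E) (y : E) (t : ℝ), 0 ≤ t → (∀ x ∈ S, ‖φ x‖ ≤ t) →
        r (ProjTensor.mk k _ E φ y) ≤ t * Q y := by
  obtain ⟨P, Q, hP, hQ, h⟩ := exists_bound₂ (k := k) (E := StrongDual k E) (F := E)
    (N := fun φ y => r (ProjTensor.mk k _ E φ y))
    (by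
      refine (isOpen_lt (hr.comp continuous_mk) continuous_const).mem_nhds ?_
      change r (ProjTensor.mk k _ E 0 0) < 1
      rw [map_zero, map_zero]
      exact one_pos)
    (by
      intro a c x y ha hc
      rw [LinearMap.map_smul, LinearMap.map_smul, LinearMap.smul_apply, seminorm_ofReal_smul _ hc,
        seminorm_ofReal_smul _ ha]
      ring)
  obtain ⟨S, hS, ε, hε, hSP⟩ := exists_dual_bound (mem_nhds_of_continuous hP (map_zero P))
  have hPS : ∀ (φ : StrongDual k E) (t : ℝ), 0 ≤ t → (∀ x ∈ S, ‖φ x‖ ≤ t) → P φ ≤ ε⁻¹ * t := by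
    intro φ t ht hφ
    have key : ∀ δ > 0, P φ ≤ ε⁻¹ * (t + δ) := by
      intro δ hδ
      have hpos : 0 < ε * (t + δ)⁻¹ := by positivity
      have h1 : P (((ε * (t + δ)⁻¹ : ℝ) : k) • φ) < 1 := by
        refine hSP _ fun x hx => ?_
        rw [smul_apply, norm_smul, RCLike.norm_ofReal, abs_of_pos hpos, mul_assoc]
        refine mul_lt_of_lt_one_right hε ?_
        rw [inv_mul_lt_iff₀ (by positivity)]
        linarith [hφ x hx]
      rw [seminorm_ofReal_smul _ hpos.le] at h1
      have h2 : P φ = (ε * (t + δ)⁻¹ * P φ) * (ε⁻¹ * (t + δ)) := by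
        field_simp
      rw [h2]
      exact mul_le_of_le_one_left (by positivity) h1.le
    have h1 : Tendsto (fun δ : ℝ => ε⁻¹ * (t + δ)) (𝓝[>] 0) (𝓝 (ε⁻¹ * (t + 0))) := by
      apply tendsto_nhdsWithin_of_tendsto_nhds
      exact Continuous.tendsto (by fun_prop) 0
    rw [add_zero] at h1
    exact ge_of_tendsto h1 (eventually_mem_nhdsWithin.mono fun δ hδ => key δ hδ)
  refine ⟨S, (Real.toNNReal ε⁻¹) • Q, hS, hQ.const_smul (Real.toNNReal ε⁻¹),
    fun φ y t ht hφ => (h φ y).trans ?_⟩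
  have h2 : ((Real.toNNReal ε⁻¹) • Q) y = ε⁻¹ * Q y := by
    change (Real.toNNReal ε⁻¹ : ℝ) * Q y = _
    rw [Real.coe_toNNReal _ (inv_nonneg.2 hε.le)]
  rw [h2]
  have := mul_le_mul_of_nonneg_right (hPS φ t ht hφ) (apply_nonneg Q y)
  linarith

/-- The finite rank operator attached to an algebraic tensor. -/
noncomputable def opOf : ProjTensor k (StrongDual k E) E →ₗ[k] E →L[k] E :=
  (TensorProduct.lift (LinearMap.mk₂ k
    (fun (φ : StrongDual k E) (y : E) => φ.smulRight y)
    (fun φ ψ y => by ext x; simp [add_smul]) (fun c φ y => by ext x; simp [mul_smul])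
    (fun φ y z => by ext x; simp) (fun c φ y => by ext x; exact smul_comm (φ x) c y)) :
    StrongDual k E ⊗[k] E →ₗ[k] E →L[k] E)

theorem opOf_mk (φ : StrongDual k E) (x y : E) : opOf (ProjTensor.mk k _ E φ y) x = φ x • y := by
  have : opOf (ProjTensor.mk k _ E φ y) = φ.smulRight y := TensorProduct.lift.tmul φ y
  rw [this]
  rfl

/-- The seminorms `sup_{x ∈ S} p (u x)` are continuous for the projective topology. -/
theorem nhds_opOf [PolynormableSpace k E] {S : Set E} (hS : IsVonNBounded k S) {p : Seminorm k E}
    (hp : Continuous p) {ε : ℝ} (hε : 0 < ε) :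
    {u : ProjTensor k (StrongDual k E) E | ∀ x ∈ S, p (opOf u x) < ε} ∈ 𝓝 0 := by
  obtain ⟨P, hP, hPS⟩ := exists_seminorm_of_mem_nhds (k := k) (nhds_dual_bound hS one_pos)
  have hPS' : ∀ φ : StrongDual k E, ∀ x ∈ S, ‖φ x‖ ≤ P φ := by
    intro φ x hx
    refine le_of_forall_pos_le_add fun δ hδ => ?_
    have hpos : 0 < P φ + δ := by have := apply_nonneg P φ; positivity
    have h1 := hPS (((P φ + δ)⁻¹ : ℝ) • φ) ?_ x hx
    · rw [smul_apply, norm_smul, Real.norm_of_nonneg (inv_nonneg.2 hpos.le),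
        inv_mul_lt_iff₀ hpos, mul_one] at h1
      exact h1.le
    · have h2 : (((P φ + δ)⁻¹ : ℝ) • φ) = (((P φ + δ)⁻¹ : ℝ) : k) • φ := by
        ext z
        simp [RCLike.real_smul_eq_coe_mul]
      rw [h2, seminorm_ofReal_smul _ (inv_nonneg.2 hpos.le), inv_mul_lt_iff₀ hpos]
      linarith
  have hν : Continuous (projSem P p) := continuous_of_mk_le hP hp (projSem_mk_le P p)
  have hmem : {u : ProjTensor k (StrongDual k E) E | projSem P p u < ε} ∈ 𝓝 0 :=
    (isOpen_lt hν continuous_const).mem_nhds (by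
      change projSem P p 0 < ε
      rwa [map_zero])
  filter_upwards [hmem] with u hu
  intro x hx
  obtain ⟨N, hN⟩ : ∃ N : Seminorm k (ProjTensor k (StrongDual k E) E), ∀ v, N v = p (opOf v x) :=
    ⟨Seminorm.of (fun v => p (opOf v x))
      (fun v w => by rw [map_add, add_apply]; exact map_add_le_add p _ _)
      (fun c v => by rw [map_smul, smul_apply, map_smul_eq_mul]), fun v => rfl⟩
  have hle : N ≤ projSem P p := le_projSem fun φ y => by
    rw [hN, opOf_mk, map_smul_eq_mul]
    exact mul_le_mul_of_nonneg_right (hPS' φ x hx) (apply_nonneg p y)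
  rw [← hN]
  exact (hle u).trans_lt hu

/-- If `E` is nuclear, then the topology of uniform convergence on bounded sets of the associated
operators is finer than the projective topology. -/
theorem opOf_induced [NuclearSpace k E] (r : Seminorm k (ProjTensor k (StrongDual k E) E))
    (hr : Continuous r) :
    ∃ (S : Set E) (q : Seminorm k E) (c : ℝ), IsVonNBounded k S ∧ Continuous q ∧ 0 < c ∧
      ∀ (u : ProjTensor k (StrongDual k E) E) (t : ℝ), 0 ≤ t →
        (∀ x ∈ S, q (opOf u x) ≤ t) → r u ≤ c * t := by
  obtain ⟨S, Q, hS, hQ, hrQ⟩ := mk_induced r hr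
  obtain ⟨q, hq, f, y, hf, hy, hlim⟩ := NuclearSpace.nuclear Q hQ
  refine ⟨S, q, (∑' n, Q (y n)) + 1, hS, hq, ?_, fun u t ht hu => ?_⟩
  · have : 0 ≤ ∑' n, Q (y n) := tsum_nonneg fun n => apply_nonneg Q _
    linarith
  let T : ℕ → ProjTensor k (StrongDual k E) E → ProjTensor k (StrongDual k E) E :=
    fun N v => ∑ n ∈ Finset.range N, ProjTensor.mk k _ E ((f n).comp (opOf v)) (y n)
  have hT : ∀ v, Tendsto (fun N => r (v - T N v)) atTop (𝓝 0) := by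
    intro v
    induction v using ProjTensor.induction with
    | h0 =>
      have : ∀ N, r (0 - T N 0) = 0 := by
        intro N
        simp only [T, map_zero, ContinuousLinearMap.comp_zero, LinearMap.zero_apply,
          Finset.sum_const_zero, sub_zero]
      simp only [this]
      exact tendsto_const_nhds
    | ht φ z =>
      have h1 : ∀ N, ProjTensor.mk k _ E φ z - T N (ProjTensor.mk k _ E φ z)
          = ProjTensor.mk k _ E φ (z - ∑ n ∈ Finset.range N, f n z • y n) := by
        intro N
        rw [map_sub, map_sum]
        congr 1
        refine Finset.sum_congr rfl fun n _ => ?_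
        have : (f n).comp (opOf (ProjTensor.mk k _ E φ z)) = f n z • φ := by
          ext x
          rw [ContinuousLinearMap.comp_apply, opOf_mk, map_smul, smul_apply, smul_eq_mul,
            smul_eq_mul, mul_comm]
        rw [this, map_smul, LinearMap.smul_apply, map_smul]
      obtain ⟨M, hM, hMS⟩ := exists_bound_on hS (p := (normSeminorm k k).comp φ.toLinearMap)
        (continuous_norm.comp φ.continuous)
      have h2 : Tendsto (fun N => M * Q (z - ∑ n ∈ Finset.range N, f n z • y n)) atTop (𝓝 0) := by
        simpa using (hlim z).const_mul M
      refine squeeze_zero (fun N => apply_nonneg r _) (fun N => ?_) h2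
      rw [h1]
      exact hrQ φ _ M hM.le hMS
    | ha v w hv hw =>
      have h1 : ∀ N, v + w - T N (v + w) = (v - T N v) + (w - T N w) := by
        intro N
        have : T N (v + w) = T N v + T N w := by
          simp only [T, map_add, ContinuousLinearMap.comp_add, LinearMap.add_apply,
            Finset.sum_add_distrib]
        rw [this]
        abel
      have h2 := hv.add hw
      rw [add_zero] at h2
      refine squeeze_zero (fun N => apply_nonneg r _) (fun N => ?_) h2
      rw [h1]
      exact map_add_le_add r _ _
  have hb : ∀ N, r u ≤ r (u - T N u) + ((∑' n, Q (y n)) + 1) * t := by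
    intro N
    have h1 : r (T N u) ≤ ((∑' n, Q (y n)) + 1) * t := by
      calc r (T N u) ≤ ∑ n ∈ Finset.range N, r (ProjTensor.mk k _ E ((f n).comp (opOf u)) (y n)) :=
            seminorm_sum_le _ _ _
        _ ≤ ∑ n ∈ Finset.range N, t * Q (y n) := by
            refine Finset.sum_le_sum fun n _ => hrQ _ _ t ht fun x hx => ?_
            exact (hf n (opOf u x)).trans (hu x hx)
        _ = (∑ n ∈ Finset.range N, Q (y n)) * t := by rw [← Finset.mul_sum, mul_comm]
        _ ≤ _ := by
            refine mul_le_mul_of_nonneg_right ?_ ht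
            have := hy.sum_le_tsum (Finset.range N) fun n _ => apply_nonneg Q (y n)
            linarith
    have h2 := map_add_le_add r (u - T N u) (T N u)
    rw [sub_add_cancel] at h2
    linarith
  have h3 := ((hT u).add_const (((∑' n, Q (y n)) + 1) * t))
  rw [zero_add] at h3
  exact ge_of_tendsto' h3 hb

/-- If `E` is nuclear, every continuous endomorphism is, uniformly on bounded sets, a limit of
operators of finite rank. -/
theorem exists_opOf_near [NuclearSpace k E] (T : E →L[k] E) {S : Set E} (hS : IsVonNBounded k S)
    {p : Seminorm k E} (hp : Continuous p) {ε : ℝ} (hε : 0 < ε) :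
    ∃ u : ProjTensor k (StrongDual k E) E, ∀ x ∈ S, p (opOf u x - T x) ≤ ε := by
  obtain ⟨q, hq, f, y, hf, hy, hlim⟩ := NuclearSpace.nuclear p hp
  obtain ⟨M, hM, hMS⟩ := exists_bound_on hS (p := q.comp T.toLinearMap) (hq.comp T.continuous)
  have htail : Tendsto (fun N => (∑' n, p (y n)) - ∑ n ∈ Finset.range N, p (y n)) atTop (𝓝 0) := by
    have := hy.hasSum.tendsto_sum_nat.const_sub (∑' n, p (y n))
    rwa [sub_self] at this
  obtain ⟨N, hN⟩ := (htail.eventually (gt_mem_nhds (div_pos hε hM))).exists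
  refine ⟨∑ n ∈ Finset.range N, ProjTensor.mk k _ E ((f n).comp T) (y n), fun x hx => ?_⟩
  have h0 : opOf (∑ n ∈ Finset.range N, ProjTensor.mk k _ E ((f n).comp T) (y n)) x
      = ∑ n ∈ Finset.range N, f n (T x) • y n := by
    rw [map_sum, sum_apply]
    exact Finset.sum_congr rfl fun n _ => opOf_mk _ _ _
  rw [h0, map_sub_rev]
  have hb : ∀ K, N ≤ K → p (T x - ∑ n ∈ Finset.range N, f n (T x) • y n)
      ≤ p (T x - ∑ n ∈ Finset.range K, f n (T x) • y n) + ε := by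
    intro K hK
    have e : T x - ∑ n ∈ Finset.range N, f n (T x) • y n
        = (T x - ∑ n ∈ Finset.range K, f n (T x) • y n)
          + ∑ n ∈ Finset.Ico N K, f n (T x) • y n := by
      rw [← Finset.sum_range_add_sum_Ico _ hK]
      abel
    rw [e]
    refine (map_add_le_add p _ _).trans (add_le_add le_rfl ?_)
    calc p (∑ n ∈ Finset.Ico N K, f n (T x) • y n)
        ≤ ∑ n ∈ Finset.Ico N K, p (f n (T x) • y n) := seminorm_sum_le _ _ _
      _ ≤ ∑ n ∈ Finset.Ico N K, M * p (y n) := by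
          refine Finset.sum_le_sum fun n _ => ?_
          rw [map_smul_eq_mul]
          exact mul_le_mul_of_nonneg_right ((hf n _).trans (hMS x hx)) (apply_nonneg p _)
      _ = M * ∑ n ∈ Finset.Ico N K, p (y n) := (Finset.mul_sum _ _ _).symm
      _ ≤ M * (ε / M) := by
          refine mul_le_mul_of_nonneg_left ?_ hM.le
          have h1 := Finset.sum_range_add_sum_Ico (fun n => p (y n)) hK
          have h2 := hy.sum_le_tsum (Finset.range K) fun n _ => apply_nonneg p (y n)
          linarith
      _ = ε := by field_simp
  have h3 := (hlim (T x)).add_const ε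
  rw [zero_add] at h3
  exact ge_of_tendsto h3 (eventually_atTop.2 ⟨N, hb⟩)

theorem lamAt_coe [PolynormableSpace k E] [T2Space E] [CompleteSpace E] (x : E)
    (u : ProjTensor k (StrongDual k E) E) :
    lamAt x (u : CTensor k (StrongDual k E) E) = opOf u x := by
  induction u using ProjTensor.induction with
  | h0 => rw [Completion.coe_zero, map_zero, map_zero, zero_apply]
  | ht φ y => exact (lamAt_tmul x φ y).trans (opOf_mk φ x y).symm
  | ha u v hu hv => rw [Completion.coe_add, map_add, hu, hv, map_add, add_apply]

theorem nhds_near (T : E →L[k] E) {S : Set E} (hS : IsVonNBounded k S) {q : Seminorm k E}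
    (hq : Continuous q) {ε : ℝ} (hε : 0 < ε) : {g : E →L[k] E | ∀ x ∈ S, q (g x - T x) < ε} ∈ 𝓝 T := by
  have h1 : {g : E →L[k] E | ∀ x ∈ S, g x ∈ {y | q y < ε}} ∈ 𝓝 (0 : E →L[k] E) :=
    (ContinuousLinearMap.hasBasis_nhds_zero (σ := RingHom.id k) (E := E) (F := E)).mem_of_mem
      (i := (S, {y | q y < ε})) ⟨hS, (isOpen_lt hq continuous_const).mem_nhds (by
        change q 0 < ε
        rwa [map_zero])⟩
  have h2 : Tendsto (fun g : E →L[k] E => g - T) (𝓝 T) (𝓝 0) :=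
    (continuous_id.sub continuous_const).tendsto' T 0 (sub_self T)
  filter_upwards [h2 h1] with g hg
  exact hg

section

variable [NuclearSpace k E] [T2Space E] [CompleteSpace E]

theorem lam_surjective (T : E →L[k] E) :
    ∃ b : CTensor k (StrongDual k E) E, ∀ x, lam b x = T x := by
  let F : Filter (ProjTensor k (StrongDual k E) E) := comap (fun u => opOf u) (𝓝 T)
  have hne : F.NeBot := by
    refine comap_neBot_iff.2 fun t ht => ?_
    have h2 : Tendsto (fun g : E →L[k] E => g + T) (𝓝 0) (𝓝 T) :=
      (continuous_id.add continuous_const).tendsto' 0 T (zero_add T)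
    obtain ⟨⟨S, V⟩, ⟨hS, hV⟩, h⟩ :=
      (ContinuousLinearMap.hasBasis_nhds_zero (σ := RingHom.id k) (E := E) (F := E)).mem_iff.1
        (h2 ht)
    obtain ⟨p, hp, hpV⟩ := exists_seminorm_of_mem_nhds (k := k) hV
    obtain ⟨u, hu⟩ := exists_opOf_near T hS hp (half_pos one_pos)
    refine ⟨u, ?_⟩
    have h3 : opOf u - T ∈ (fun g : E →L[k] E => g + T) ⁻¹' t :=
      h fun x hx => hpV _ ((hu x hx).trans_lt (by norm_num))
    change opOf u - T + T ∈ t at h3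
    rwa [sub_add_cancel] at h3
  have hF : Cauchy F := by
    refine ⟨hne, ?_⟩
    rw [uniformity_eq_comap_nhds_zero, ← tendsto_iff_comap]
    intro V hV
    obtain ⟨r, hr, hrV⟩ := exists_seminorm_of_mem_nhds (k := k) hV
    obtain ⟨S, q, c, hS, hq, hc, h⟩ := opOf_induced r hr
    have hA : {u | ∀ x ∈ S, q (opOf u x - T x) < (4 * c)⁻¹} ∈ F :=
      preimage_mem_comap (nhds_near T hS hq (by positivity))
    rw [Filter.mem_map]
    filter_upwards [prod_mem_prod hA hA] with ⟨u, v⟩ huv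
    refine hrV _ (lt_of_le_of_lt (h _ (2 * (4 * c)⁻¹) (by positivity) fun x hx => ?_) ?_)
    · have e : opOf (v - u) x = (opOf v x - T x) - (opOf u x - T x) := by
        rw [map_sub, sub_apply]
        abel
      change q (opOf (v - u) x) ≤ _
      rw [e]
      have h1 := map_sub_le_add q (opOf v x - T x) (opOf u x - T x)
      have h2 := huv.1 x hx
      have h3 := huv.2 x hx
      linarith
    · have : c * (2 * (4 * c)⁻¹) = 1 / 2 := by
        field_simp
        norm_num
      rw [this]
      norm_num
  obtain ⟨b, hb⟩ := CompleteSpace.complete (hF.map (Completion.uniformContinuous_coe _))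
  refine ⟨b, fun x => ?_⟩
  have h1 : Tendsto (fun u : ProjTensor k (StrongDual k E) E =>
      lamAt x (u : CTensor k (StrongDual k E) E)) F (𝓝 (lamAt x b)) :=
    ((lamAt x).continuous.tendsto b).comp hb
  have h2 : Tendsto (fun u : ProjTensor k (StrongDual k E) E =>
      lamAt x (u : CTensor k (StrongDual k E) E)) F (𝓝 (T x)) := by
    simp only [lamAt_coe]
    exact ((continuous_eval_const x).tendsto T).comp tendsto_comap
  exact tendsto_nhds_unique h1 h2

theorem lam_injective : Function.Injective (lam : CTensor k (StrongDual k E) E →ₗ[k] E →ₗ[k] E) := by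
  rw [injective_iff_map_eq_zero]
  intro d hd
  have hd' : ∀ x, lamAt x d = 0 := fun x => LinearMap.congr_fun hd x
  by_contra hne
  obtain ⟨⟨R, hR⟩, hRd⟩ := (PolynormableSpace.withSeminorms k
    (CTensor k (StrongDual k E) E)).separating_of_T1 d hne
  refine hRd ?_
  change R d = 0
  obtain ⟨f, hf⟩ : ∃ f : ProjTensor k (StrongDual k E) E →ₗ[k] CTensor k (StrongDual k E) E,
      ∀ v : ProjTensor k (StrongDual k E) E, f v = (v : CTensor k (StrongDual k E) E) :=
    ⟨{ toFun := fun v => (v : CTensor k (StrongDual k E) E)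
       map_add' := Completion.coe_add
       map_smul' := Completion.coe_smul }, fun v => rfl⟩
  have hrf : ∀ v, (R.comp f) v = R (v : CTensor k (StrongDual k E) E) := fun v => by
    rw [Seminorm.comp_apply, hf]
  have hr : Continuous (R.comp f) := by
    have : (fun v => (R.comp f) v) = fun v : ProjTensor k (StrongDual k E) E =>
      R (v : CTensor k (StrongDual k E) E) := funext hrf
    change Continuous fun v => (R.comp f) v
    rw [this]
    exact hR.comp (Completion.continuous_coe _)
  obtain ⟨S, q, c, hS, hq, hc, h⟩ := opOf_induced (R.comp f) hr
  let G : Filter (ProjTensor k (StrongDual k E) E) :=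
    comap (fun u : ProjTensor k (StrongDual k E) E => (u : CTensor k (StrongDual k E) E)) (𝓝 d)
  have hG : G.NeBot := (Completion.isDenseInducing_coe).comap_nhds_neBot d
  have hlim : Tendsto (fun u : ProjTensor k (StrongDual k E) E =>
      (u : CTensor k (StrongDual k E) E)) G (𝓝 d) := tendsto_comap
  have hC : Cauchy G := cauchy_nhds.comap (Completion.isUniformInducing_coe _).comap_uniformity.le
  refine le_antisymm (le_of_forall_pos_le_add fun ε hε => ?_) (apply_nonneg R d)
  rw [zero_add]
  have hU : {u : ProjTensor k (StrongDual k E) E | ∀ x ∈ S, q (opOf u x) < c⁻¹ * ε} ∈ 𝓝 0 :=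
    nhds_opOf hS hq (by positivity)
  have hCU : Tendsto (fun w : ProjTensor k (StrongDual k E) E × ProjTensor k (StrongDual k E) E =>
      w.2 - w.1) (G ×ˢ G) (𝓝 0) := by
    have := hC.2
    rwa [uniformity_eq_comap_nhds_zero, ← tendsto_iff_comap] at this
  obtain ⟨A, hA, hAU⟩ := mem_prod_same_iff.1 (hCU hU)
  have hbound : ∀ u ∈ A, R (u : CTensor k (StrongDual k E) E) ≤ ε := by
    intro u hu
    rw [← hrf]
    have h1 : (R.comp f) u ≤ c * (c⁻¹ * ε) := by
      refine h u _ (by positivity) fun x hx => ?_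
      have h2 : Tendsto (fun v : ProjTensor k (StrongDual k E) E => q (opOf u x - opOf v x)) G
          (𝓝 (q (opOf u x - 0))) := by
        refine (hq.tendsto _).comp (tendsto_const_nhds.sub ?_)
        have := ((lamAt (k := k) x).continuous.tendsto d).comp hlim
        rw [hd' x] at this
        refine this.congr fun v => ?_
        exact lamAt_coe x v
      rw [sub_zero] at h2
      refine le_of_tendsto h2 ?_
      filter_upwards [hA] with v hv
      have h3 := hAU (Set.mk_mem_prod hv hu) x hx
      change q (opOf (u - v) x) < _ at h3
      rw [map_sub, sub_apply] at h3
      exact h3.le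
    rwa [mul_inv_cancel_left₀ hc.ne'] at h1
  exact le_of_tendsto ((hR.tendsto d).comp hlim) (mem_of_superset hA hbound)

/-- For nuclear `E`, every continuous endomorphism of `E` is `λ(b)` for a unique `b ∈ E° ⊗̂ E`. -/
theorem lam_existsUnique (T : E →L[k] E) :
    ∃! b : CTensor k (StrongDual k E) E, lam b = T.toLinearMap := by
  obtain ⟨b, hb⟩ := lam_surjective T
  have hb' : lam b = T.toLinearMap := LinearMap.ext hb
  exact ⟨b, hb', fun c hc => lam_injective (hc.trans hb'.symm)⟩

variable (k E) in
/-- The element `ρ = ∑ f^i ⊗ x_i` of `E° ⊗̂ E` with `λ(ρ) = Id`. -/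
noncomputable def rho : CTensor k (StrongDual k E) E :=
  (lam_existsUnique (ContinuousLinearMap.id k E)).choose

theorem lam_rho : lam (rho k E) = LinearMap.id :=
  (lam_existsUnique (ContinuousLinearMap.id k E)).choose_spec.1

end

end LambdaBijective

section Hopf

variable (k H : Type*) [RCLike k] [Ring H] [Algebra k H] [UniformSpace H] [IsUniformAddGroup H]
  [ContinuousMul H] [ContinuousSMul k H] [NuclearSpace k H] [T2Space H] [CompleteSpace H]

/-- The multiplication `H ⊗̂ H → H`. -/
noncomputable def mulMap : CTensor k H H →L[k] H := lift (LinearMap.mul k H) continuous_mul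

variable {k H} in
/-- The map `φ ⊗̂ Id : H ⊗̂ H → H`, `x ⊗ y ↦ φ(x) y`, for a continuous functional `φ`. -/
noncomputable def sliceLeft (φ : StrongDual k H) : CTensor k H H →L[k] H :=
  lift ((LinearMap.lsmul k H).comp φ.toLinearMap)
    ((φ.continuous.comp continuous_fst).smul continuous_snd)

variable {k H} in
/-- The map `Id ⊗̂ φ : H ⊗̂ H → H`, `x ⊗ y ↦ φ(y) x`, for a continuous functional `φ`. -/
noncomputable def sliceRight (φ : StrongDual k H) : CTensor k H H →L[k] H :=
  (sliceLeft φ).comp comm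

/-- A topological Hopf algebra structure on the (complete, Hausdorff, nuclear) topological
algebra `H`: continuous comultiplication `H → H ⊗̂ H`, counit and antipode satisfying the Hopf
algebra axioms. The antipode is required to be invertible (with continuous inverse), since `S⁻¹`
enters the definition of the algebra `H° ⊗̂ H` below. -/
class TopologicalHopfAlgebra where
  comul : H →L[k] CTensor k H H
  counit : StrongDual k H
  antipode : H ≃L[k] H
  coassoc : assoc.comp ((map comul (.id k H)).comp comul) = (map (.id k H) comul).comp comul
  counit_left : ∀ h, sliceLeft counit (comul h) = h
  counit_right : ∀ h, sliceRight counit (comul h) = h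
  comul_one : comul 1 = tmul k 1 1
  comul_mul : ∀ g h, comul (g * h)
    = map (mulMap k H) (mulMap k H) (interchange (tmul k (comul g) (comul h)))
  counit_one : counit 1 = 1
  counit_mul : ∀ g h, counit (g * h) = counit g * counit h
  antipode_left : ∀ h,
    mulMap k H (map antipode.toContinuousLinearMap (.id k H) (comul h)) = algebraMap k H (counit h)
  antipode_right : ∀ h,
    mulMap k H (map (.id k H) antipode.toContinuousLinearMap (comul h)) = algebraMap k H (counit h)

/-- The underlying space `H° ⊗̂ H` of the algebra `B_AYD^top(H)`. -/
abbrev BAYD : Type _ := CTensor k (StrongDual k H) H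

variable {k H}
variable [TopologicalHopfAlgebra k H]

open TopologicalHopfAlgebra

variable (k H) in
/-- The antipode `S : H → H`. -/
def S : H →L[k] H := (antipode : H ≃L[k] H).toContinuousLinearMap

variable (k H) in
/-- The inverse `S⁻¹ : H → H` of the antipode. -/
def Sinv : H →L[k] H := (antipode : H ≃L[k] H).symm.toContinuousLinearMap

/-- The iterated comultiplication `h ↦ h₁ ⊗ (h₂ ⊗ h₃)`. -/
noncomputable def comul₂ : H →L[k] CTensor k H (CTensor k H H) := (map (.id k H) comul).comp comul

/-- The product `(φ ψ)(x) = φ(x₁) ψ(x₂)` of the dual algebra `H°`. -/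
noncomputable def conv (φ ψ : StrongDual k H) : StrongDual k H :=
  ψ.comp ((sliceLeft φ).comp comul)

theorem continuous_conv (φ : StrongDual k H) : Continuous (conv φ) :=
  (ContinuousLinearMap.precomp k ((sliceLeft φ).comp (comul (k := k) (H := H)))).continuous

/-- The functional `x ↦ φ(σ(c) x τ(a))`, i.e. `φ₁(σ(c)) φ₃(τ(a)) φ₂` for the coproduct
`φ₁ ⊗ φ₂ ⊗ φ₃` of `φ` dual to the multiplication of `H`. -/
noncomputable def twist (σ τ : H →L[k] H) (φ : StrongDual k H) (a c : H) : StrongDual k H where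
  toLinearMap := φ.toLinearMap.comp
    ((LinearMap.mulRight k (τ a)).comp (LinearMap.mulLeft k (σ c)))
  cont := φ.continuous.comp ((continuous_const.mul continuous_id).mul continuous_const)

theorem twist_apply (σ τ : H →L[k] H) (φ : StrongDual k H) (a c x : H) :
    twist σ τ φ a c x = φ (σ c * x * τ a) := rfl

theorem continuous_twist (σ τ : H →L[k] H) (φ : StrongDual k H) :
    Continuous fun z : H × H => twist σ τ φ z.1 z.2 := by
  let b : H →ₗ[k] H →ₗ[k] StrongDual k H := LinearMap.mk₂ k (twist σ τ φ)
    (fun a a' c => by ext x; simp [twist_apply, mul_add])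
    (fun r a c => by ext x; simp [twist_apply])
    (fun a c c' => by ext x; simp [twist_apply, add_mul])
    (fun r a c => by ext x; simp [twist_apply])
  refine continuous_bilin_of_tendsto b ?_
  obtain ⟨p, q, s, hp, hq, hs, h⟩ := exists_bound₃ (k := k)
    (N := fun a c x => ‖φ (σ c * x * τ a)‖)
    (by
      have hc : Continuous fun z : H × H × H => ‖φ (σ z.2.1 * z.2.2 * τ z.1)‖ := by fun_prop
      refine (isOpen_lt hc continuous_const).mem_nhds ?_
      change ‖φ (σ 0 * 0 * τ 0)‖ < 1
      simp)
    (by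
      intro r₁ r₂ r₃ a c x h₁ h₂ h₃
      simp only [map_smul, smul_mul_assoc, mul_smul_comm, norm_smul, RCLike.norm_ofReal,
        abs_of_nonneg h₁, abs_of_nonneg h₂, abs_of_nonneg h₃]
      ring)
  intro U hU
  obtain ⟨S, hS, ε, hε, hSU⟩ := exists_dual_bound hU
  obtain ⟨M, hM, hMS⟩ := exists_bound_on hS hs
  have hc : Continuous fun z : H × H => p z.1 * q z.2 * M := by fun_prop
  have h0 : Tendsto (fun z : H × H => p z.1 * q z.2 * M) (𝓝 0) (𝓝 0) :=
    hc.tendsto' 0 0 (by simp)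
  rw [Filter.mem_map]
  filter_upwards [h0.eventually (gt_mem_nhds hε)] with z hz
  refine hSU _ fun x hx => lt_of_le_of_lt ?_ hz
  refine (h z.1 z.2 x).trans (mul_le_mul_of_nonneg_left (hMS x hx) ?_)
  exact mul_nonneg (apply_nonneg p _) (apply_nonneg q _)

theorem isContTrilinear_bmul (σ τ : H →L[k] H) (φ φ' : StrongDual k H) (h' : H) :
    IsContTrilinear k fun a b c : H =>
      (tmul k (conv φ (twist σ τ φ' a c)) (b * h') : BAYD k H) where
  fst b c := by
    have h1 : ∀ a a', twist σ τ φ' (a + a') c = twist σ τ φ' a c + twist σ τ φ' a' c := by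
      intro a a'; ext x; simp [twist_apply, mul_add]
    have h2 : ∀ (r : k) a, twist σ τ φ' (r • a) c = r • twist σ τ φ' a c := by
      intro r a; ext x; simp [twist_apply]
    refine ⟨fun a a' => ?_, fun r a => ?_⟩
    · rw [h1, conv, ContinuousLinearMap.add_comp, map_add, LinearMap.add_apply]
      rfl
    · rw [h2, conv, ContinuousLinearMap.smul_comp, map_smul, LinearMap.smul_apply]
      rfl
  snd a c := ⟨fun b b' => by rw [add_mul, map_add], fun r b => by rw [smul_mul_assoc, map_smul]⟩
  thd a b := by
    have h1 : ∀ c c', twist σ τ φ' a (c + c') = twist σ τ φ' a c + twist σ τ φ' a c' := by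
      intro c c'; ext x; simp [twist_apply, add_mul]
    have h2 : ∀ (r : k) c, twist σ τ φ' a (r • c) = r • twist σ τ φ' a c := by
      intro r c; ext x; simp [twist_apply]
    refine ⟨fun c c' => ?_, fun r c => ?_⟩
    · rw [h1, conv, ContinuousLinearMap.add_comp, map_add, LinearMap.add_apply]
      rfl
    · rw [h2, conv, ContinuousLinearMap.smul_comp, map_smul, LinearMap.smul_apply]
      rfl
  cont := by
    have h1 : Continuous fun w : H × H × H => conv φ (twist σ τ φ' w.1 w.2.2) :=
      (continuous_conv φ).comp ((continuous_twist σ τ φ').comp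
        (continuous_fst.prodMk (continuous_snd.comp continuous_snd)))
    exact continuous_tmul_comp h1 ((continuous_fst.comp continuous_snd).mul continuous_const)

/-- The product of elementary tensors
`(φ ⊗ h) (φ' ⊗ h') = φ'₁(σ(h₃)) φ'₃(τ(h₁)) φ φ'₂ ⊗ h₂ h'` in `H° ⊗̂ H`. -/
noncomputable def bmul (σ τ : H →L[k] H) (φ : StrongDual k H) (h : H) (φ' : StrongDual k H)
    (h' : H) : BAYD k H :=
  lift₃ _ (isContTrilinear_bmul σ τ φ φ' h') (comul₂ h)

/-- `m` is the multiplication of `H° ⊗̂ H` extending the product of elementary tensors by separate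
continuity. (There is at most one such `m`, since elementary tensors span a dense subspace.) -/
structure IsExtension (σ τ : H →L[k] H) (m : BAYD k H →ₗ[k] BAYD k H →ₗ[k] BAYD k H) : Prop where
  continuous_left : ∀ b', Continuous fun b => m b b'
  continuous_right : ∀ b, Continuous fun b' => m b b'
  tmul_tmul : ∀ φ h φ' h', m (tmul k φ h) (tmul k φ' h') = bmul σ τ φ h φ' h'

/-- A topological right module `V` over `B = H° ⊗̂ H`, whose multiplication is the separately
continuous extension of `bmul σ τ` and whose unit is `ε ⊗ 1`. Like the multiplication of `B`, the
action `V × B → V` is separately continuous, and its restriction to `H = ε ⊗ H` makes `V` a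
topological right `H`-module (`V × H → V` is continuous). By separate continuity it is enough to
state associativity on elementary tensors, see `RightModule.act_act`. -/
structure RightModule (σ τ : H →L[k] H) (V : Type*) [AddCommGroup V] [Module k V]
    [TopologicalSpace V] where
  act : V →ₗ[k] BAYD k H →ₗ[k] V
  continuous_left : ∀ b, Continuous fun v => act v b
  continuous_right : ∀ v, Continuous fun b => act v b
  continuous_H : Continuous fun z : V × H => act z.1 (tmul k counit z.2)
  act_one : ∀ v, act v (tmul k counit 1) = v
  act_tmul : ∀ v φ h φ' h',
    act (act v (tmul k φ h)) (tmul k φ' h') = act v (bmul σ τ φ h φ' h')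

namespace RightModule

variable {σ τ : H →L[k] H} {V : Type*} [AddCommGroup V] [Module k V] [UniformSpace V]

theorem act_act [T2Space V] (M : RightModule σ τ V)
    {m : BAYD k H →ₗ[k] BAYD k H →ₗ[k] BAYD k H} (hm : IsExtension σ τ m) (v : V)
    (b b' : BAYD k H) : M.act (M.act v b) b' = M.act v (m b b') := by
  induction b' using CTensor.induction with
  | hc =>
    exact isClosed_eq (M.continuous_right _) ((M.continuous_right v).comp (hm.continuous_right b))
  | h0 => simp only [map_zero]
  | ha c c' hc hc' => simp only [map_add, hc, hc']
  | ht φ' h' =>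
    induction b using CTensor.induction with
    | hc =>
      exact isClosed_eq ((M.continuous_left _).comp (M.continuous_right v))
        ((M.continuous_right v).comp (hm.continuous_left _))
    | h0 => simp only [map_zero, LinearMap.zero_apply]
    | ha c c' hc hc' => simp only [map_add, LinearMap.add_apply, hc, hc']
    | ht φ h => rw [M.act_tmul, hm.tmul_tmul]

variable [IsUniformAddGroup V] [ContinuousSMul k V] [PolynormableSpace k V]

/-- The continuous linear map `B → H ⊗̂ V`, `φ ⊗ x ↦ x ⊗ v · (φ ⊗ 1)`. -/
noncomputable def coactMap (M : RightModule σ τ V) (v : V) : BAYD k H →L[k] CTensor k H V :=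
  lift (((tmul k).compl₂ ((M.act v).comp ((tmul k).flip 1))).flip)
    (continuous_tmul_comp continuous_snd ((M.continuous_right v).comp
      (continuous_tmul_comp continuous_fst continuous_const)))

theorem coactMap_tmul (M : RightModule σ τ V) (v : V) (φ : StrongDual k H) (x : H) :
    M.coactMap v (tmul k φ x) = tmul k x (M.act v (tmul k φ 1)) :=
  lift_tmul _ _ φ x

/-- The left coaction `∇(v) = ∑ x_i ⊗ v · (f^i ⊗ 1) ∈ H ⊗̂ V`, where `ρ = ∑ f^i ⊗ x_i`. -/
noncomputable def coact (M : RightModule σ τ V) (v : V) : CTensor k H V :=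
  M.coactMap v (rho k H)

variable [T2Space V] [CompleteSpace V]

/-- The continuous linear map `H ⊗̂ V → V`, `h ⊗ v ↦ v · h`, for the right action
`v · h = v · (ε ⊗ h)`. -/
noncomputable def actH (M : RightModule σ τ V) : CTensor k H V →L[k] V :=
  lift ((M.act.compl₂ (tmul k (counit : StrongDual k H))).flip)
    (M.continuous_H.comp continuous_swap)

theorem actH_tmul (M : RightModule σ τ V) (h : H) (v : V) :
    M.actH (tmul k h v) = M.act v (tmul k counit h) :=
  lift_tmul _ _ h v

/-- Stability: `v₍₀₎ · v₍₋₁₎ = v` for all `v`, where `∇(v) = v₍₋₁₎ ⊗ v₍₀₎`. -/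
def IsStable (M : RightModule σ τ V) : Prop :=
  ∀ v, M.actH (M.coact v) = v

/-- The set of vectors fixed by `ρ`. -/
def fixedByRho (M : RightModule σ τ V) : Set V :=
  {v | M.act v (rho k H) = v}

end RightModule

end Hopf

end TopHopf

namespace TopHopf

open TopologicalHopfAlgebra

/-! ### Slices and products of elementary tensors -/

variable {k H : Type*} [RCLike k] [Ring H] [Algebra k H] [UniformSpace H] [IsUniformAddGroup H]
  [ContinuousMul H] [ContinuousSMul k H] [NuclearSpace k H] [T2Space H] [CompleteSpace H]

/-! Stability and invariance under $\rho$ turn out to be the same equation, vector by vector. Fix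
$v$. Coacting and then acting by $\mathcal H$ makes sense for any $b\in B$ in place of $\rho$: send
$b$ through $\varphi\otimes x\mapsto x\otimes v\cdot(\varphi\otimes 1)$ into $\mathcal
H\,\widehat\otimes_\pi\,V$, then apply $h\otimes w\mapsto w\cdot(\varepsilon\otimes h)$. On an
elementary tensor the result is $(v\cdot(\varphi\otimes 1))\cdot(\varepsilon\otimes x)$, which by
associativity of the action is $v\cdot\big((\varphi\otimes 1)(\varepsilon\otimes x)\big)$.

The algebraic heart is therefore the factorization $(\varphi\otimes 1)(\varepsilon\otimes
x)=\varphi\otimes x$ in $B$ (`bmul_one_counit`). It holds because the iterated coproduct of $1$ is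
$1\otimes 1\otimes 1$, so the twisting of the second functional is only by $\sigma(1)$ and
$\tau(1)$, both equal to $1$; what remains is the convolution $\varphi\varepsilon=\varphi$ and the
product $1\cdot x=x$.

So two continuous linear maps $B\to V$, the composite just described and $b\mapsto v\cdot b$, agree
on elementary tensors. These span a dense subspace and $V$ is Hausdorff, so the maps agree on all of
$B$ (`actH_coactMap`). Evaluating at $\rho$ gives $v_{(0)}\cdot v_{(-1)}=v\cdot\rho$, and the
equivalence is immediate (`isStable_iff`).

The twisting maps enter only through $\sigma(1)=\tau(1)=1$. This is why the argument is carried out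
for general $\sigma,\tau$: it then covers both multiplications, $(\sigma,\tau)=(S^{-1},S^2)$ and
$(\sigma,\tau)=(S,{\rm Id})$, at once. -/

theorem sliceLeft_tmul (φ : StrongDual k H) (x y : H) : sliceLeft φ (tmul k x y) = φ x • y :=
  lift_tmul _ _ x y

theorem sliceRight_tmul (φ : StrongDual k H) (x y : H) : sliceRight φ (tmul k x y) = φ y • x := by
  rw [sliceRight, ContinuousLinearMap.comp_apply, comm_tmul, sliceLeft_tmul]

theorem mulMap_tmul (x y : H) : mulMap k H (tmul k x y) = x * y :=
  lift_tmul _ _ x y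

/-- Both sides are the functional $\varphi\otimes\psi$ on $\mathcal H\,\widehat\otimes_\pi\,\mathcal
H$; only the order in which the two legs are evaluated differs. The exchange is needed because
`conv` evaluates its first factor first, whereas the right counit axiom contracts the second leg. -/
theorem comp_sliceLeft (φ ψ : StrongDual k H) :
    ψ.comp (sliceLeft φ) = φ.comp (sliceRight ψ) :=
  CTensor.ext_map fun x y => by
    rw [ContinuousLinearMap.comp_apply, ContinuousLinearMap.comp_apply, sliceLeft_tmul,
      sliceRight_tmul, map_smul, map_smul, smul_eq_mul, smul_eq_mul, mul_comm]

/-! ### Unit and counit identities, and the factorization of elementary tensors -/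

variable [TopologicalHopfAlgebra k H]

/-- The right counit axiom, read in the dual:
$\varphi(x_{(1)})\varepsilon(x_{(2)})=\varphi\big(x_{(1)}\varepsilon(x_{(2)})\big)=\varphi(x)$. Thus
$\varepsilon$ is a right unit for the convolution product. -/
theorem conv_counit (φ : StrongDual k H) : conv φ counit = φ := by
  ext x
  -- After exchanging the slices at $\Delta(x)$, the inner map on the right is ${\rm
  -- Id}\otimes\varepsilon$, which `counit_right` collapses to $x$. The left side is `conv φ counit
  -- x` by definition.
  have h := DFunLike.congr_fun (comp_sliceLeft φ (counit : StrongDual k H)) (comul x)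
  rw [ContinuousLinearMap.comp_apply, ContinuousLinearMap.comp_apply, counit_right] at h
  exact h

/-- Since $1$ is grouplike and $\varepsilon(1)=1$, the left antipode axiom at $1$ reads $S(1)\cdot
1=1$. -/
theorem S_one : S k H 1 = 1 := by
  have h := antipode_left (k := k) (H := H) 1
  rw [comul_one, map_tmul, mulMap_tmul, counit_one, map_one (algebraMap k H)] at h
  -- The factor `ContinuousLinearMap.id k H 1` and the bundled `antipode` are replaced by the
  -- definitionally equal $1$ and `S`, so that `mul_one` can rewrite.
  have h' : S k H 1 * 1 = 1 := h
  rwa [mul_one] at h'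

theorem Sinv_one : Sinv k H 1 = 1 :=
  (ContinuousLinearEquiv.symm_apply_eq _).2 (S_one (k := k) (H := H)).symm

theorem comul₂_one : (comul₂ : H →L[k] _) 1 = tmul k 1 (tmul k 1 1) := by
  rw [comul₂, ContinuousLinearMap.comp_apply, comul_one, map_tmul, comul_one]
  -- What is left is the identity map on the first leg, applied to $1$.
  rfl

/-- The only place where the values of $\sigma$ and $\tau$ matter: the twisted functional is
$x\mapsto\varphi(\sigma(1)\,x\,\tau(1))$. -/
theorem twist_one {σ τ : H →L[k] H} (hσ : σ 1 = 1) (hτ : τ 1 = 1) (φ : StrongDual k H) :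
    twist σ τ φ 1 1 = φ := by
  ext x
  rw [twist_apply, hσ, hτ, one_mul, mul_one]

/-- In `H° ⊗̂ H` one has `(φ ⊗ 1) (ε ⊗ x) = φ ⊗ x`. -/
theorem bmul_one_counit {σ τ : H →L[k] H} (hσ : σ 1 = 1) (hτ : τ 1 = 1) (φ : StrongDual k H)
    (x : H) : bmul σ τ φ 1 counit x = tmul k φ x := by
  -- Because the iterated coproduct of $1$ is an elementary tensor, the extended trilinear map
  -- inside `bmul` can be evaluated directly, giving $\varphi\,\varepsilon\otimes 1\cdot x$ once the
  -- twist by units has been removed.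
  rw [bmul, comul₂_one, lift₃_tmul, twist_one hσ hτ, conv_counit, one_mul]

/-! ### Coaction followed by action, and stability -/

namespace RightModule

variable {σ τ : H →L[k] H} {V : Type*} [AddCommGroup V] [Module k V] [UniformSpace V]
  [IsUniformAddGroup V] [ContinuousSMul k V] [PolynormableSpace k V] [T2Space V] [CompleteSpace V]

/-- Following `b ↦ ∑ x_i ⊗ v · (f^i ⊗ 1)` by the action of `H` gives `b ↦ v · b`. -/
theorem actH_coactMap (hσ : σ 1 = 1) (hτ : τ 1 = 1) (M : RightModule σ τ V) (v : V)
    (b : BAYD k H) : M.actH (M.coactMap v b) = M.act v b := by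
  -- Separate continuity in the $B$-variable makes $b\mapsto v\cdot b$ a continuous linear map,
  -- which is what allows it to be compared with the composite on elementary tensors alone, by
  -- density.
  have h : M.actH.comp (M.coactMap v) = ⟨M.act v, M.continuous_right v⟩ :=
    CTensor.ext_map fun φ x => by
      -- The chain is $\varphi\otimes x\mapsto x\otimes v\cdot(\varphi\otimes 1)\mapsto
      -- (v\cdot(\varphi\otimes 1))\cdot(\varepsilon\otimes x)$; associativity and the factorization
      -- turn the last term into $v\cdot(\varphi\otimes x)$.
      rw [ContinuousLinearMap.comp_apply, coactMap_tmul, actH_tmul, M.act_tmul,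
        bmul_one_counit hσ hτ]
      rfl
  exact DFunLike.congr_fun h b

/-- Taking $b=\rho$ in `actH_coactMap` identifies $v_{(0)}\cdot v_{(-1)}$ with $v\cdot\rho$. The
equivalence therefore holds for each vector separately, before quantifying over $V$. -/
theorem isStable_iff (hσ : σ 1 = 1) (hτ : τ 1 = 1) (M : RightModule σ τ V) :
    M.IsStable ↔ M.fixedByRho = Set.univ := by
  rw [Set.eq_univ_iff_forall]
  exact forall_congr' fun v => by
    rw [coact, actH_coactMap hσ hτ]
    rfl

end RightModule

end TopHopf

/-- The two conjuncts are the two multiplications of $B$, encoded by the maps $\sigma$ (applied to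
$h_{(3)}$) and $\tau$ (applied to $h_{(1)}$). Each reduces to checking that its pair fixes $1$. -/
theorem mainTheorem3 {k H V : Type*} [RCLike k]
    [Ring H] [Algebra k H] [UniformSpace H] [IsUniformAddGroup H] [ContinuousMul H]
    [ContinuousSMul k H] [T2Space H] [CompleteSpace H] [TopHopf.NuclearSpace k H]
    [TopHopf.TopologicalHopfAlgebra k H]
    [AddCommGroup V] [Module k V] [UniformSpace V] [IsUniformAddGroup V] [ContinuousSMul k V]
    [T2Space V] [CompleteSpace V] [PolynormableSpace k V] :
    (∀ M : TopHopf.RightModule (TopHopf.Sinv k H) ((TopHopf.S k H).comp (TopHopf.S k H)) V,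
      M.IsStable ↔ M.fixedByRho = Set.univ) ∧
    (∀ M : TopHopf.RightModule (TopHopf.S k H) (ContinuousLinearMap.id k H) V,
      M.IsStable ↔ M.fixedByRho = Set.univ) :=
  ⟨fun M => M.isStable_iff TopHopf.Sinv_one
      -- Here $\tau=S^2$, so $S(1)=1$ is applied twice.
      (by rw [ContinuousLinearMap.comp_apply, TopHopf.S_one, TopHopf.S_one]),
    fun M => M.isStable_iff TopHopf.S_one rfl⟩
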